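/- **Setting.** Fix an integer $k\ge 1$. Observations take values in $\mathbb N=\{1,2,3,\dots\}$; let $\mathcal F$ be the set of probability densities with respect to the counting measure on $\mathbb N$, i.e. $f:\mathbb N\to[0,\infty)$ with $\sum_l f(l)=1$. On $\mathcal F^k$ put $d(f,g)=\max_{1\le i\le k}\sum_l|f_i(l)-g_i(l)|$, and let $N(\epsilon,A,d)$ be the minimal number of $d$-balls of radius $\epsilon$ needed to cover $A$. Let $\Delta_k=\{u\in[0,1]^k:\sum_iu_i=1\}$, let $\Delta_k^k$ be the set of $k\times k$ matrices with rows in $\Delta_k$, and let $\|\cdot\|$ be the maximum of the absolute values of the entries. The true parameters are $Q^*\in\Delta_k^k$ with $Q^*_{ij}\ge \underline q^*$ for all $i,j$, for some $\underline q^*>0$, and $f^*=(f_1^*,\dots,f_k^*)\in\mathcal F^k$. The priors are a probability measure $\Pi_Q$ on $\Delta_k^k$ and $\Pi_f^{(k)}=DP(G)^{\otimes k}$ on $\mathcal F^k$, where $DP(G)$ is the Dirichlet process with base measure $G$, a finite positive measure on $\mathbb N$. The symbols $\lesssim,\gtrsim$ mean inequality up to a positive multiplicative constant. **Hypotheses.**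 * (Q0) $\Pi_Q$ has a density $\pi_Q(Q)=\pi_q(Q_{1,\cdot})\cdots\pi_q(Q_{k,\cdot})$ with respect to Lebesgue measure on $\Delta_k^k$, and $\pi_Q$ is continuous at $Q^*$ with $\pi_Q(Q^*)>0$. * (P) There are constants $0<a\le A$ and $\alpha\ge2$ with $a\,l^{-\alpha}\le G(\{l\})\le A\,l^{-\alpha}$ for all $l\in\mathbb N$. * (D) There are constants $m,c,K>0$ such that every $f=f_j^*$, $1\le j\le k$, satisfies $f(l)\le d\,e^{-cl^m}$ for all $l$, for some constant $d>0$, and $\sum_{l\le N}\frac{-\log f(l)}{l}\lesssim N^K$ for all large $N$ (in particular $f(l)>0$ for all $l$). * (I) There is $\delta>0$ such that $\sum_{l\ge N}f_i^*(l)\log^2 f_j^*(l)\lesssim \exp(-N^m(c-\delta))$ for all large $N$ and all $1\le i,j\le k$. **Conclusion.** Let $t_0\ge\frac12\max(\frac1m+1,\frac Km)$ and $t>4t_0$, and for $n\ge2$ put $$\tilde\epsilon_n=\frac{(\log n)^{t_0}}{\sqrt n},\qquad \epsilon_n=\frac{(\log n)^{t}}{\sqrt n}.$$ Let $u_n=1$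 for all $n$ if $\tilde\epsilon_n\gtrsim n^{-s}$ for some $s<1/2$, and $u_n=(\log n)^{3/2}$ for all $n$ otherwise. Then there are positive constants $C_f,C,C',C_Q$ such that the following hold, with relations between sequences understood for $n\ge2$. (A) There are measurable sets $B_n\subset\mathcal F^k$ with $\Pi_f^{(k)}(B_n)\gtrsim\exp(-C_fn\tilde\epsilon_n^2)$ such that for every $f\in B_n$ $$\sum_l f_i^*(l)\log^2\frac{f_j^*(l)}{f_j(l)}\le\frac{\tilde\epsilon_n^2}{u_n}\quad(1\le i,j\le k),$$ and there are a set $S\subset\mathbb N$ and densities $\tilde f_1,\dots,\tilde f_k\in\mathcal F$ with, for all $1\le i,j\le k$, $$\sum_{l\in S}\frac{|f_j^*(l)-f_j(l)|^2}{f_j^*(l)}\le\frac{\tilde\epsilon_n^2}{u_n},\qquad \sum_{l\notin S}\tilde f_j(l)\le\tilde\epsilon_n^2,\qquad \sum_{l\notin S}f_j^*(l)\le\frac{\tilde\epsilon_n^2}{u_n},$$ $$\sum_{l\in S}f_i^*(l)\max_{1\le j'\le k}\log\frac{\tilde f_{j'}(l)}{f_{j'}(l)}\le\tilde\epsilon_n^2,\qquad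 \sum_{l\in S}\frac{|f_j^*(l)-\tilde f_j(l)|^2}{\tilde f_j(l)}\le\tilde\epsilon_n^2 .$$ (B) There are measurable sets $\mathcal F_n\subset\mathcal F^k$ with $\Pi_f^{(k)}(\mathcal F_n^c)=o(\exp(-Cn\tilde\epsilon_n^2))$ as $n\to\infty$ and $N(\epsilon_n/12,\mathcal F_n,d)\lesssim\exp(C'n\epsilon_n^2)$. (C) $C_Q+C_f+C_K<C$ with $C_K=4+\log(2k/\underline q^*)+10^4k^2/(\underline q^*)^5$, and $$\Pi_Q\big(\{Q:\|Q-Q^*\|\le\tilde\epsilon_n/\sqrt{u_n}\}\big)\gtrsim\exp(-C_Qn\tilde\epsilon_n^2).$$ -/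

import Mathlib

open MeasureTheory ProbabilityTheory Filter Topology
open scoped ENNReal

noncomputable section

namespace DiscreteHMM

/-! ### Emission densities and the Dirichlet process

Observations live in `{1, 2, 3, …}` (the type `ℕ+`) and the dominating measure is the counting
measure, so that integrals are sums over `ℕ+`. -/

/-- The set `𝓕` of probability densities with respect to the counting measure on `{1, 2, …}`,
with the σ-algebra generated by the evaluations `f ↦ f l`. -/
abbrev Density : Type := {f : ℕ+ → ℝ // (∀ l, 0 ≤ f l) ∧ HasSum f 1}

instance : CoeFun Density (fun _ => ℕ+ → ℝ) := ⟨Subtype.val⟩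

/-- The gamma law with shape `a` and rate `1`; shape `0` is the Dirac mass at `0`. -/
def gammaLaw (a : ℝ) : Measure ℝ := if 0 < a then gammaMeasure a 1 else Measure.dirac 0

instance (a : ℝ) : IsProbabilityMeasure (gammaLaw a) := by
  unfold gammaLaw
  split_ifs with h
  · exact isProbabilityMeasure_gammaMeasure h one_pos
  · infer_instance

/-- Normalisation `γ ↦ (γ l / ∑ₘ γ m)ₗ` of a non-negative sequence with positive finite sum. (A sum
that is not convergent is `0` in Lean, so `0 < ∑' m, γ m` contains the convergence.) Sequences that
cannot be normalised are sent to the point mass at `1`. -/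
def normalise (γ : ℕ+ → ℝ) : Density :=
  open Classical in
  if h : (∀ l, 0 ≤ γ l) ∧ 0 < ∑' m, γ m then
    ⟨fun l => γ l / ∑' m, γ m, fun l => div_nonneg (h.1 l) h.2.le, by
      have hs : Summable γ := by
        by_contra hc
        exact absurd h.2 (by simp [tsum_eq_zero_of_not_summable hc])
      simpa [div_self h.2.ne'] using hs.hasSum.div_const (∑' m, γ m)⟩
  else
    ⟨fun l => if l = 1 then 1 else 0, fun l => by dsimp only; split_ifs <;> simp, by
      simpa using hasSum_ite_eq (1 : ℕ+) (1 : ℝ)⟩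

theorem measurable_normalise : Measurable normalise := by
  classical
  have ht : Measurable (fun γ : ℕ+ → ℝ => ∑' m, γ m) :=
    Measurable.tsum (fun m => measurable_pi_apply m)
  have hset : MeasurableSet {γ : ℕ+ → ℝ | (∀ l, 0 ≤ γ l) ∧ 0 < ∑' m, γ m} := by
    refine MeasurableSet.inter ?_ (measurableSet_lt measurable_const ht)
    have : {γ : ℕ+ → ℝ | ∀ l, 0 ≤ γ l} = ⋂ l, {γ : ℕ+ → ℝ | 0 ≤ γ l} := by
      ext γ; simp
    change MeasurableSet {γ : ℕ+ → ℝ | ∀ l, 0 ≤ γ l}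
    rw [this]
    exact MeasurableSet.iInter fun l => measurableSet_le measurable_const (measurable_pi_apply l)
  have hval : Measurable (fun γ : ℕ+ → ℝ => (normalise γ).val) := by
    have : (fun γ : ℕ+ → ℝ => (normalise γ).val) = fun γ l =>
        if (∀ l, 0 ≤ γ l) ∧ 0 < ∑' m, γ m then γ l / ∑' m, γ m else if l = 1 then 1 else 0 := by
      funext γ l
      unfold normalise
      split_ifs <;> simp_all
    rw [this]
    refine measurable_pi_lambda _ fun l => ?_
    exact Measurable.ite hset ((measurable_pi_apply l).div ht) measurable_const
  exact hval.subtype_mk (h := fun γ => (normalise γ).property)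

/-- The law of the Dirichlet process `DP(G)` on the probability measures on `{1, 2, …}`, where the
finite positive base measure `G` is given by its point masses `G l`: the masses of the singletons
are `γ l / ∑ₘ γ m` with independent `γ l ∼ Gamma(G l, 1)`. By additivity of independent gamma
variables, the masses of any finite partition `(A₁, …, Aᵣ)` of `{1, 2, …}` are then
`Dirichlet(G(A₁), …, G(Aᵣ))` distributed. -/
def dirichletProcess (G : ℕ+ → ℝ) : Measure Density :=
  (Measure.infinitePi fun l => gammaLaw (G l)).map normalise

instance (G : ℕ+ → ℝ) : IsProbabilityMeasure (dirichletProcess G) :=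
  Measure.isProbabilityMeasure_map measurable_normalise.aemeasurable

/-- The prior `DP(G)^{⊗ k}` on `𝓕^k`. -/
def emissionPrior (k : ℕ) (G : ℕ+ → ℝ) : Measure (Fin k → Density) :=
  Measure.pi fun _ => dirichletProcess G

/-- The distance `d(f, g) = max_i ‖f_i - g_i‖_{L₁}` on `𝓕^k`. -/
def emissionDist {k : ℕ} (f g : Fin k → Density) : ℝ :=
  ⨆ i, ∑' l, |f i l - g i l|

/-- The covering number `N(ε, A, D)`: the least number of (open) balls of radius `ε` for `D`,
centred in `A`, that are needed to cover `A`; it is `⊤` if no finite number suffices. -/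
def coveringNumber {X : Type*} (ε : ℝ) (A : Set X) (D : X → X → ℝ) : ℕ∞ :=
  ⨅ (T : Set X) (_ : T ⊆ A) (_ : ∀ x ∈ A, ∃ y ∈ T, D x y < ε), T.encard

/-! ### Transition matrices -/

/-- `Δ_k^k(q)`: the `k × k` transition matrices all of whose entries are at least `q`. -/
def transitionMatrices (k : ℕ) (q : ℝ) : Set (Fin k → Fin k → ℝ) :=
  {Q | ∀ i, Q i ∈ stdSimplex ℝ (Fin k) ∧ ∀ j, q ≤ Q i j}

/-- `(k-1)`-dimensional Lebesgue measure on the simplex `Δ_k`, in the coordinates `u_j`, `j ≠ 0`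
(another choice of coordinates gives the same measure). -/
def simplexLebesgue (k : ℕ) [NeZero k] : Measure (Fin k → ℝ) :=
  ((volume : Measure ({j : Fin k // j ≠ 0} → ℝ)).map
    (fun v j => if h : j ≠ 0 then v ⟨j, h⟩ else 1 - ∑ i, v i)).restrict (stdSimplex ℝ (Fin k))

/-- Lebesgue measure on `Δ_k^k`, the product of the Lebesgue measures on the `k` rows. -/
def transitionLebesgue (k : ℕ) [NeZero k] : Measure (Fin k → Fin k → ℝ) :=
  Measure.pi fun _ => simplexLebesgue k

/-- Condition (Q0) on the prior `P` on transition matrices and the true transition matrix `Q'`: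
`P` has a density `π_Q(Q) = ∏ᵢ π_q(Q_{i,·})` with respect to Lebesgue measure on `Δ_k^k` which is
continuous and positive at `Q'`. -/
def AssumptionQ0 {k : ℕ} [NeZero k] (P : Measure (Fin k → Fin k → ℝ))
    (Q' : Fin k → Fin k → ℝ) : Prop :=
  ∃ πq : (Fin k → ℝ) → ℝ, Measurable πq ∧ (∀ u, 0 ≤ πq u) ∧
    P = (transitionLebesgue k).withDensity (fun Q => ENNReal.ofReal (∏ i, πq (Q i))) ∧
    0 < ∏ i, πq (Q' i) ∧
    ContinuousWithinAt (fun Q : Fin k → Fin k → ℝ => ∏ i, πq (Q i)) (transitionMatrices k 0) Q'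

/-! ### The base measure and the true emission densities -/

/-- Condition (P): polynomial tails of the base measure. -/
def AssumptionP (G : ℕ+ → ℝ) : Prop :=
  ∃ a A α : ℝ, 0 < a ∧ a ≤ A ∧ 2 ≤ α ∧
    ∀ l : ℕ+, a * (l : ℝ) ^ (-α) ≤ G l ∧ G l ≤ A * (l : ℝ) ^ (-α)

/-- The class `𝓓(m, c, K)`. Since `-log 0 = +∞`, the second bound forces `f l > 0` for all `l`;
this is spelled out because `Real.log 0 = 0` in Lean. -/
def envelopeClass (m c K : ℝ) : Set Density :=
  {f | (∃ d : ℝ, 0 < d ∧ ∀ l : ℕ+, f l ≤ d * Real.exp (-c * (l : ℝ) ^ m)) ∧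
    (∀ l, 0 < f l) ∧
    ∃ B : ℝ, 0 < B ∧ ∀ᶠ N : ℕ+ in atTop,
      ∑ l ∈ Finset.Icc 1 N, -Real.log (f l) / (l : ℝ) ≤ B * (N : ℝ) ^ K}

/-- `log²(x / y)` for `x, y ≥ 0`, with value `+∞` where the logarithm is infinite. -/
def logSqRatio (x y : ℝ) : ℝ≥0∞ :=
  open Classical in
  if x = 0 ∨ y = 0 then ⊤ else ENNReal.ofReal (Real.log (x / y) ^ 2)

/-- Condition (I) on the tails of the true emission densities `f'`. The series has non-negative
terms and is summed in `[0, ∞]`. -/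
def AssumptionI {k : ℕ} (f' : Fin k → Density) (m c : ℝ) : Prop :=
  ∃ δ : ℝ, 0 < δ ∧ ∃ B : ℝ, 0 < B ∧ ∀ᶠ N : ℕ+ in atTop, ∀ i j : Fin k,
    ∑' l : Set.Ici N, ENNReal.ofReal (f' i l) * logSqRatio (f' j l) 1
      ≤ ENNReal.ofReal (B * Real.exp (-(N : ℝ) ^ m * (c - δ)))

/-! ### The conditions of the general concentration theorem

Statements about sequences are made for all `n ≥ 2`: at `n = 1` the rates `n^{-1/2} (log n)^t`
vanish, whereas the general setting needs positive rates. -/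

/-- The sequence `u_n` attached to the rate `e = ε̃`: it is `1` if `ε̃_n ≳ n^{-s}` for some
`s < 1/2`, and `(log n)^{3/2}` otherwise. -/
def uSeq (e : ℕ → ℝ) (n : ℕ) : ℝ :=
  open Classical in
  if ∃ s : ℝ, s < 1 / 2 ∧ (fun n : ℕ => (n : ℝ) ^ (-s)) =O[atTop] e then 1
  else Real.log n ^ (3 / 2 : ℝ)

/-- The inequalities (A.1)–(A.6) for `f`, with `e` in the place of `ε̃_n` and `u` of `u_n`.
Series with non-negative terms are summed in `[0, ∞]`, where `x / 0 = ∞` for `x > 0`. -/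
def KLConditions {k : ℕ} (f' f : Fin k → Density) (e u : ℝ) : Prop :=
  (∀ i j, ∑' l, ENNReal.ofReal (f' i l) * logSqRatio (f' j l) (f j l)
      ≤ ENNReal.ofReal (e ^ 2 / u)) ∧
  ∃ (S : Set ℕ+) (g : Fin k → Density),
    (∀ j, ∑' l : S, ENNReal.ofReal (|f' j l - f j l| ^ 2) / ENNReal.ofReal (f' j l)
      ≤ ENNReal.ofReal (e ^ 2 / u)) ∧
    (∀ j, ∑' l : (Sᶜ : Set ℕ+), ENNReal.ofReal (g j l) ≤ ENNReal.ofReal (e ^ 2)) ∧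
    (∀ j, ∑' l : (Sᶜ : Set ℕ+), ENNReal.ofReal (f' j l) ≤ ENNReal.ofReal (e ^ 2 / u)) ∧
    -- the logarithms in (A.5) are finite, the series converges absolutely, and the bound holds
    (∀ j, ∀ l ∈ S, 0 < g j l ∧ 0 < f j l) ∧
    (∀ i, Summable (fun l : S => f' i l * ⨆ j, Real.log (g j l / f j l)) ∧
      ∑' l : S, f' i l * ⨆ j, Real.log (g j l / f j l) ≤ e ^ 2) ∧
    (∀ j, ∑' l : S, ENNReal.ofReal (|f' j l - g j l| ^ 2) / ENNReal.ofReal (g j l)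
      ≤ ENNReal.ofReal (e ^ 2))

/-- Condition (A) with constant `Cf`, for the prior `P` on `𝓕^k`, the true emission densities `f'`
and the rate `e = ε̃`. -/
def AssumptionA {k : ℕ} (P : Measure (Fin k → Density)) (f' : Fin k → Density) (e : ℕ → ℝ)
    (Cf : ℝ) : Prop :=
  0 < Cf ∧ ∃ B : ℕ → Set (Fin k → Density), (∀ n, MeasurableSet (B n)) ∧
    (∃ b : ℝ, 0 < b ∧ ∀ n : ℕ, 2 ≤ n → b * Real.exp (-Cf * n * e n ^ 2) ≤ P.real (B n)) ∧
    ∀ n : ℕ, 2 ≤ n → ∀ f ∈ B n, KLConditions f' f (e n) (uSeq e n)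

/-- Condition (B) with constants `C`, `C'`, for the prior `P` on `𝓕^k` and the rates `e = ε̃` and
`e' = ε`. -/
def AssumptionB {k : ℕ} (P : Measure (Fin k → Density)) (e e' : ℕ → ℝ) (C C' : ℝ) : Prop :=
  0 < C ∧ 0 < C' ∧ ∃ F : ℕ → Set (Fin k → Density), (∀ n, MeasurableSet (F n)) ∧
    (fun n : ℕ => P.real (F n)ᶜ) =o[atTop] (fun n : ℕ => Real.exp (-C * n * e n ^ 2)) ∧
    ∃ b : ℝ, 0 < b ∧ ∀ n : ℕ, 2 ≤ n →
      ((coveringNumber (e' n / 12) (F n) emissionDist : ℕ∞) : ℝ≥0∞)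
        ≤ ENNReal.ofReal (b * Real.exp (C' * n * e' n ^ 2))

/-- The constant `C_K = 4 + log (2k/q) + 10⁴ k²/q⁵`. -/
def constCK (k : ℕ) (q : ℝ) : ℝ := 4 + Real.log (2 * k / q) + 10 ^ 4 * (k : ℝ) ^ 2 / q ^ 5

/-- Condition (C), for the prior `P` on transition matrices, the true transition matrix `Q'` with
entries at least `q`, the rate `e = ε̃`, and the constants `Cf` of (A) and `C` of (B). The norm is
the maximum of the absolute values of the entries. -/
def AssumptionC {k : ℕ} (P : Measure (Fin k → Fin k → ℝ)) (Q' : Fin k → Fin k → ℝ) (q : ℝ)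
    (e : ℕ → ℝ) (Cf C : ℝ) : Prop :=
  ∃ CQ : ℝ, 0 < CQ ∧ CQ + Cf + constCK k q < C ∧
    ∃ b : ℝ, 0 < b ∧ ∀ n : ℕ, 2 ≤ n →
      b * Real.exp (-CQ * n * e n ^ 2) ≤ P.real {Q | ‖Q - Q'‖ ≤ e n / √(uSeq e n)}

/-- The rate `n^{-1/2} (log n)^t`. -/
def logRate (t : ℝ) (n : ℕ) : ℝ := 1 / √(n : ℝ) * Real.log n ^ t

end DiscreteHMM

end

noncomputable section

namespace DiscreteHMM

/-! Write x = n ε̃_n² = (log n)^{2t₀}. Since 2t₀ ≥ 1, any fixed power of n is at most exp(O(x)).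
Hence polynomially small radii are affordable in (A) and (C), and of the tolerance ε̃_n²/u_n only
the lower bound of order n^{-3} is used (`le_logRate_sq_div_uSeq`). The Dirichlet process is handled
through its independent gamma weights γ_l, whose shapes G(l) ≤ A l^{-2} are summable.

(A) The set B_n asks that f agree with f* up to a log-ratio ρ on {1, …, N} and stay above exp(-V(l))
beyond N, with V polynomial. Taking S = {1, …, N} and f̃ = f*, every inequality reduces to a bound
by a multiple of ρ, because f* V² has tails of order exp(-(c/2) N^m) (`klConditions_of_close`). A
box of gamma weights lands in this set after normalisation. Its mass costs c N^m for each of the N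
head coordinates, plus G(l)(-log f*(l)) ≲ -log f*(l)/l summed over the head, plus a tail
contribution of order at most N^m: in all N^{m+1} + N^K in the exponent
(`exists_le_infinitePi_gammaBox`). With N of order (log n)^{1/m} this is (log n)^{1/m+1} + (log
n)^{K/m} ≲ x, which is the condition on t₀.

(B) Because the shapes are summable, only about x of the weights exceed e^{-O(x)} l^{-2}, and those
have indices below e^{O(x)}, outside an event of probability exp(-(C+1)x) up to a constant
(`exists_dirichletProcess_sparseDensities`). The sieve therefore consists of densities concentrated
on R = O(x) atoms of {1, …, L} with log L = O(x). Listing the atoms and rounding their masses covers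
it with log-cardinality O(R log L) = O(x²) = O((log n)^{4t₀}) (`coveringNumber_sparseDensities_le`).
This works for every C.

(C) The prior density is bounded below near Q*, so a ball of radius r has mass at least a power of
r, and r may be taken of order n^{-2}. As (B) allows any C, the constant C is chosen after C_f and
C_Q. -/

/-! ### Bounds for the gamma function and the gamma laws -/

/-- Convexity puts Γ below its chord on [1, A + 1], which starts at Γ(1) = 1. The exponent is linear
in g, so these factors contribute only a convergent series when g runs through the shapes G(l). -/
lemma Gamma_one_add_le_exp {A : ℝ} (hA : 0 < A) :
    ∃ M : ℝ, 0 ≤ M ∧ ∀ g : ℝ, 0 < g → g ≤ A → Real.Gamma (g + 1) ≤ Real.exp (M * g) := by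
  refine ⟨|Real.Gamma (A + 1) - 1| / A, by positivity, fun g hg hgA => ?_⟩
  have h1 : 0 ≤ 1 - g / A := by rw [sub_nonneg, div_le_one hA]; exact hgA
  have h := Real.convexOn_Gamma.2 (show (1 : ℝ) ∈ Set.Ioi 0 by simp)
    (show A + 1 ∈ Set.Ioi 0 by simp only [Set.mem_Ioi]; linarith) h1
    (show 0 ≤ g / A by positivity) (by ring)
  simp only [smul_eq_mul, Real.Gamma_one] at h
  have e : (1 - g / A) * 1 + g / A * (A + 1) = g + 1 := by field_simp; ring
  rw [e] at h
  have h2 : g / A * (Real.Gamma (A + 1) - 1) ≤ g / A * |Real.Gamma (A + 1) - 1| :=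
    mul_le_mul_of_nonneg_left (le_abs_self _) (by positivity)
  have h3 := Real.add_one_le_exp (|Real.Gamma (A + 1) - 1| / A * g)
  have h4 : |Real.Gamma (A + 1) - 1| / A * g = g / A * |Real.Gamma (A + 1) - 1| := by ring
  linarith

lemma exists_le_Gamma_add_one {A : ℝ} (hA : 0 < A) :
    ∃ b : ℝ, 0 < b ∧ ∀ g : ℝ, 0 < g → g ≤ A → b ≤ Real.Gamma (g + 1) := by
  have hc : ContinuousOn Real.Gamma (Set.Icc 1 (A + 1)) := by
    intro x hx
    refine (Real.differentiableAt_Gamma fun m => ?_).continuousAt.continuousWithinAt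
    have : (0 : ℝ) ≤ m := m.cast_nonneg
    have := hx.1
    linarith
  obtain ⟨x, hx, hmin⟩ := isCompact_Icc.exists_isMinOn (Set.nonempty_Icc.2 (by linarith)) hc
  exact ⟨Real.Gamma x, Real.Gamma_pos_of_pos (by linarith [hx.1]),
    fun g hg hgA => hmin (Set.mem_Icc.2 ⟨by linarith, by linarith⟩)⟩

lemma gammaLaw_apply {g : ℝ} (hg : 0 < g) {s : Set ℝ} (hs : MeasurableSet s) :
    gammaLaw g s = ∫⁻ x in s, gammaPDF g 1 x := by
  rw [gammaLaw, if_pos hg, gammaMeasure, withDensity_apply _ hs]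

lemma gammaLaw_Iio_zero {g : ℝ} (hg : 0 < g) : gammaLaw g (Set.Iio 0) = 0 := by
  rw [gammaLaw_apply hg measurableSet_Iio, lintegral_gammaPDF_of_nonpos le_rfl]

lemma lintegral_Ioc_rpow {g lo up : ℝ} (hg : 0 < g) (hlo : 0 ≤ lo) (h : lo ≤ up) :
    ∫⁻ x in Set.Ioc lo up, ENNReal.ofReal (x ^ (g - 1)) =
      ENNReal.ofReal ((up ^ g - lo ^ g) / g) := by
  have hi : IntervalIntegrable (fun x : ℝ => x ^ (g - 1)) volume lo up :=
    intervalIntegral.intervalIntegrable_rpow' (by linarith)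
  rw [← ofReal_integral_eq_lintegral_ofReal
    ((intervalIntegrable_iff_integrableOn_Ioc_of_le h).1 hi), ← intervalIntegral.integral_of_le h,
    integral_rpow (Or.inl (by linarith))]
  · simp
  · refine (ae_restrict_iff' measurableSet_Ioc).2 (ae_of_all _ fun x hx => ?_)
    exact Real.rpow_nonneg (hlo.trans hx.1.le) _

/-- On the interval e^{-x} ≥ e^{-up}, and what remains of the density is a pure power with an
explicit integral. The factor 1/g is absorbed into Γ(g + 1), which stays bounded as g → 0. -/
lemma le_gammaLaw_Icc {g lo up : ℝ} (hg : 0 < g) (hlo : 0 < lo) (h : lo ≤ up) :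
    ENNReal.ofReal (Real.exp (-up) * (up ^ g - lo ^ g) / Real.Gamma (g + 1)) ≤
      gammaLaw g (Set.Icc lo up) := by
  have hG := Real.Gamma_pos_of_pos hg
  calc ENNReal.ofReal (Real.exp (-up) * (up ^ g - lo ^ g) / Real.Gamma (g + 1))
      = ENNReal.ofReal (Real.exp (-up) / Real.Gamma g) *
          ENNReal.ofReal ((up ^ g - lo ^ g) / g) := by
        rw [← ENNReal.ofReal_mul (by positivity), Real.Gamma_add_one hg.ne']
        congr 1
        field_simp
    _ = ∫⁻ x in Set.Ioc lo up, ENNReal.ofReal (Real.exp (-up) / Real.Gamma g) *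
          ENNReal.ofReal (x ^ (g - 1)) := by
        rw [lintegral_const_mul' _ _ ENNReal.ofReal_ne_top, lintegral_Ioc_rpow hg hlo.le h]
    _ ≤ ∫⁻ x in Set.Ioc lo up, gammaPDF g 1 x := by
        refine setLIntegral_mono' measurableSet_Ioc fun x hx => ?_
        have hx0 : 0 < x := hlo.trans hx.1
        rw [gammaPDF_of_nonneg hx0.le, ← ENNReal.ofReal_mul (by positivity)]
        refine ENNReal.ofReal_le_ofReal ?_
        have he : Real.exp (-up) ≤ Real.exp (-x) := Real.exp_le_exp.2 (by linarith [hx.2])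
        have : Real.exp (-up) / Real.Gamma g * x ^ (g - 1) ≤
            Real.exp (-x) / Real.Gamma g * x ^ (g - 1) := by gcongr
        refine this.trans (le_of_eq ?_)
        rw [Real.one_rpow, one_mul]
        ring
    _ = gammaLaw g (Set.Ioc lo up) := (gammaLaw_apply hg measurableSet_Ioc).symm
    _ ≤ gammaLaw g (Set.Icc lo up) := measure_mono Set.Ioc_subset_Icc_self

lemma gammaLaw_Iio_le {g y : ℝ} (hg : 0 < g) (hy : 0 < y) :
    gammaLaw g (Set.Iio y) ≤ ENNReal.ofReal (y ^ g / Real.Gamma (g + 1)) := by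
  have hG := Real.Gamma_pos_of_pos hg
  have hsub : Set.Iio y ⊆ Set.Iio 0 ∪ ({0} ∪ Set.Ioc 0 y) := by
    intro x hx
    have hx' : x < y := hx
    rcases lt_trichotomy x 0 with h | h | h
    · exact Or.inl h
    · exact Or.inr (Or.inl h)
    · exact Or.inr (Or.inr ⟨h, hx'.le⟩)
  have h0 : gammaLaw g {0} = 0 := by
    rw [gammaLaw_apply hg (measurableSet_singleton 0)]
    simp
  calc gammaLaw g (Set.Iio y)
      ≤ gammaLaw g (Set.Iio 0) + (gammaLaw g {0} + gammaLaw g (Set.Ioc 0 y)) :=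
        (measure_mono hsub).trans ((measure_union_le _ _).trans
          (add_le_add le_rfl (measure_union_le _ _)))
    _ = ∫⁻ x in Set.Ioc 0 y, gammaPDF g 1 x := by
        rw [gammaLaw_Iio_zero hg, h0, gammaLaw_apply hg measurableSet_Ioc, zero_add, zero_add]
    _ ≤ ∫⁻ x in Set.Ioc 0 y, ENNReal.ofReal (1 / Real.Gamma g) *
          ENNReal.ofReal (x ^ (g - 1)) := by
        refine setLIntegral_mono' measurableSet_Ioc fun x hx => ?_
        rw [gammaPDF_of_nonneg hx.1.le, ← ENNReal.ofReal_mul (by positivity)]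
        refine ENNReal.ofReal_le_ofReal ?_
        rw [Real.one_rpow]
        have : 0 ≤ x ^ (g - 1) := Real.rpow_nonneg hx.1.le _
        exact mul_le_of_le_one_right (by positivity)
          (Real.exp_le_one_iff.2 (by linarith [hx.1]))
    _ = ENNReal.ofReal (y ^ g / Real.Gamma (g + 1)) := by
        rw [lintegral_const_mul' _ _ ENNReal.ofReal_ne_top, lintegral_Ioc_rpow hg le_rfl hy.le,
          ← ENNReal.ofReal_mul (by positivity), Real.Gamma_add_one hg.ne',
          Real.zero_rpow hg.ne']
        congr 1
        field_simp
        ring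

/-- Markov's inequality for the moment of order s. -/
lemma gammaLaw_Ioi_le_moment {g θ s : ℝ} (hg : 0 < g) (hθ : 0 < θ) (hs : 0 < s) :
    gammaLaw g (Set.Ioi θ) ≤
      ENNReal.ofReal (θ ^ (-s) * Real.Gamma (g + s) / Real.Gamma g) := by
  have hG := Real.Gamma_pos_of_pos hg
  have hgs : 0 < g + s := by linarith
  have hI : IntegrableOn (fun x : ℝ => Real.exp (-x) * x ^ (g + s - 1)) (Set.Ioi 0) :=
    Real.GammaIntegral_convergent hgs
  calc gammaLaw g (Set.Ioi θ) = ∫⁻ x in Set.Ioi θ, gammaPDF g 1 x :=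
        gammaLaw_apply hg measurableSet_Ioi
    _ ≤ ∫⁻ x in Set.Ioi θ, ENNReal.ofReal (θ ^ (-s) / Real.Gamma g) *
          ENNReal.ofReal (Real.exp (-x) * x ^ (g + s - 1)) := by
        refine setLIntegral_mono' measurableSet_Ioi fun x (hx : θ < x) => ?_
        have hx0 : 0 < x := hθ.trans hx
        rw [gammaPDF_of_nonneg hx0.le, ← ENNReal.ofReal_mul (by positivity)]
        refine ENNReal.ofReal_le_ofReal ?_
        have h1 : 1 ≤ θ ^ (-s) * x ^ s := by
          rw [Real.rpow_neg hθ.le, ← div_eq_inv_mul, ← Real.div_rpow hx0.le hθ.le]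
          exact Real.one_le_rpow ((one_le_div hθ).2 hx.le) hs.le
        have h2 : x ^ (g + s - 1) = x ^ (g - 1) * x ^ s := by
          rw [← Real.rpow_add hx0]; congr 1; ring
        rw [Real.one_rpow, one_mul, h2]
        have h3 : 0 ≤ 1 / Real.Gamma g * x ^ (g - 1) * Real.exp (-x) := by positivity
        calc _ ≤ 1 / Real.Gamma g * x ^ (g - 1) * Real.exp (-x) * (θ ^ (-s) * x ^ s) :=
              le_mul_of_one_le_right h3 h1
          _ = _ := by ring
    _ ≤ ∫⁻ x in Set.Ioi 0, ENNReal.ofReal (θ ^ (-s) / Real.Gamma g) *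
          ENNReal.ofReal (Real.exp (-x) * x ^ (g + s - 1)) :=
        lintegral_mono_set (Set.Ioi_subset_Ioi hθ.le)
    _ = ENNReal.ofReal (θ ^ (-s) * Real.Gamma (g + s) / Real.Gamma g) := by
        rw [lintegral_const_mul' _ _ ENNReal.ofReal_ne_top,
          ← ofReal_integral_eq_lintegral_ofReal hI, ← Real.Gamma_eq_integral hgs,
          ← ENNReal.ofReal_mul (by positivity)]
        · congr 1; ring
        · refine (ae_restrict_iff' measurableSet_Ioi).2 (ae_of_all _ fun x hx => ?_)
          have hx0 : (0 : ℝ) < x := hx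
          positivity

/-- The moment order s = 1/(-log θ) makes θ^{-s} = e, while Γ(g + s) ≲ 1/s = -log θ and 1/Γ(g) =
g/Γ(g + 1) ≲ g. The factor g is the point: it makes exceedance probabilities summable over the
atoms. -/
lemma exists_gammaLaw_Ioi_le {A : ℝ} (hA : 0 < A) :
    ∃ C : ℝ, 0 < C ∧ ∀ g θ : ℝ, 0 < g → g ≤ A → 0 < θ → 1 ≤ -Real.log θ →
      gammaLaw g (Set.Ioi θ) ≤ ENNReal.ofReal (C * g * -Real.log θ) := by
  obtain ⟨M, hM, hMG⟩ := Gamma_one_add_le_exp (A := A + 1) (by linarith)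
  obtain ⟨b, hb, hbG⟩ := exists_le_Gamma_add_one hA
  refine ⟨Real.exp 1 * Real.exp (M * (A + 1)) / b, by positivity, fun g θ hg hgA hθ hl => ?_⟩
  set t := -Real.log θ with ht
  have ht0 : 0 < t := by linarith
  refine (gammaLaw_Ioi_le_moment hg hθ (s := 1 / t) (by positivity)).trans
    (ENNReal.ofReal_le_ofReal ?_)
  have hs : 1 / t ≤ 1 := by rw [div_le_one ht0]; exact hl
  have hs0 : 0 < 1 / t := by positivity
  have e1 : θ ^ (-(1 / t)) = Real.exp 1 := by
    rw [Real.rpow_def_of_pos hθ]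
    congr 1
    have : Real.log θ = -t := by rw [ht]; ring
    rw [this]; field_simp
  have hgs : 0 < g + 1 / t := by positivity
  have hGp := Real.Gamma_pos_of_pos hg
  have h1 : Real.Gamma (g + 1 / t) ≤ t * Real.exp (M * (A + 1)) := by
    have h2 := hMG (g + 1 / t) hgs (by linarith)
    rw [Real.Gamma_add_one hgs.ne'] at h2
    have h3 : Real.exp (M * (g + 1 / t)) ≤ Real.exp (M * (A + 1)) := by
      apply Real.exp_le_exp.2; gcongr
    have h4 : 1 / t * Real.Gamma (g + 1 / t) ≤ (g + 1 / t) * Real.Gamma (g + 1 / t) := by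
      have := Real.Gamma_pos_of_pos hgs
      gcongr; linarith
    have h5 : Real.Gamma (g + 1 / t) = t * (1 / t * Real.Gamma (g + 1 / t)) := by field_simp
    rw [h5]
    gcongr
    linarith
  have h6 : 1 / Real.Gamma g ≤ g / b := by
    have h7 := hbG g hg hgA
    rw [Real.Gamma_add_one hg.ne'] at h7
    rw [div_le_div_iff₀ hGp hb]
    linarith
  calc θ ^ (-(1 / t)) * Real.Gamma (g + 1 / t) / Real.Gamma g
      = Real.exp 1 * Real.Gamma (g + 1 / t) * (1 / Real.Gamma g) := by rw [e1]; ring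
    _ ≤ Real.exp 1 * (t * Real.exp (M * (A + 1))) * (g / b) := by gcongr
    _ = _ := by ring

/-! ### Infinite product measures -/

/-- The rectangle is the decreasing intersection of cylinders with finitely many constraints, each
of mass at least exp(-W); continuity from above passes to the limit. -/
lemma le_infinitePi_pi {ι : Type*} [Countable ι] {X : ι → Type*} [∀ i, MeasurableSpace (X i)]
    (μ : ∀ i, Measure (X i)) [∀ i, IsProbabilityMeasure (μ i)] {t : ∀ i, Set (X i)}
    (ht : ∀ i, MeasurableSet (t i)) (w : ι → ℝ) (W : ℝ)
    (hw : ∀ i, ENNReal.ofReal (Real.exp (-w i)) ≤ μ i (t i)) (hW : ∀ s : Finset ι,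
      ∑ i ∈ s, w i ≤ W) :
    ENNReal.ofReal (Real.exp (-W)) ≤ Measure.infinitePi μ (Set.univ.pi t) := by
  have hEq : Set.univ.pi t = ⋂ s : Finset ι, (s : Set ι).pi t := by
    ext x
    simp only [Set.mem_pi, Set.mem_univ, forall_const, Set.mem_iInter]
    exact ⟨fun h s i _ => h i, fun h i => h {i} i (by simp)⟩
  rw [hEq, Antitone.measure_iInter]
  · refine le_iInf fun s => ?_
    rw [Measure.infinitePi_pi _ fun i _ => ht i]
    calc ENNReal.ofReal (Real.exp (-W)) ≤ ENNReal.ofReal (∏ i ∈ s, Real.exp (-w i)) := by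
          rw [← Real.exp_sum, Finset.sum_neg_distrib]
          exact ENNReal.ofReal_le_ofReal (Real.exp_le_exp.2 (neg_le_neg (hW s)))
      _ = ∏ i ∈ s, ENNReal.ofReal (Real.exp (-w i)) :=
          ENNReal.ofReal_prod_of_nonneg fun i _ => (Real.exp_pos _).le
      _ ≤ _ := Finset.prod_le_prod' fun i _ => hw i
  · intro s s' h x hx i hi
    exact hx i (h hi)
  · exact fun s => (MeasurableSet.pi s.countable_toSet fun i _ => ht i).nullMeasurableSet
  · exact ⟨∅, by simp⟩

lemma infinitePi_eval_preimage {ι : Type*} {X : ι → Type*} [∀ i, MeasurableSpace (X i)]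
    (μ : ∀ i, Measure (X i)) [∀ i, IsProbabilityMeasure (μ i)] (i : ι) {t : Set (X i)}
    (ht : MeasurableSet t) : Measure.infinitePi μ {x | x i ∈ t} = μ i t :=
  (measurePreserving_eval_infinitePi μ i).measure_preimage ht.nullMeasurableSet

/-- Chernoff bound for the number of coordinates in `s` that fall into prescribed sets. -/
lemma infinitePi_card_le {ι : Type*} {X : ι → Type*} [∀ i, MeasurableSpace (X i)]
    (μ : ∀ i, Measure (X i)) [∀ i, IsProbabilityMeasure (μ i)] {t : ∀ i, Set (X i)}
    (ht : ∀ i, MeasurableSet (t i)) (s : Finset ι) (p : ι → ℝ) (hp : ∀ i, 0 ≤ p i)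
    (hμ : ∀ i ∈ s, μ i (t i) ≤ ENNReal.ofReal (p i)) (R : ℕ) :
    Measure.infinitePi μ {x | ∃ J ⊆ s, J.card = R ∧ ∀ i ∈ J, x i ∈ t i} ≤
      ENNReal.ofReal (Real.exp (Real.exp 1 * ∑ i ∈ s, p i - R)) := by
  have hsub : {x : ∀ i, X i | ∃ J ⊆ s, J.card = R ∧ ∀ i ∈ J, x i ∈ t i} ⊆
      ⋃ J ∈ s.powersetCard R, (J : Set ι).pi t := by
    rintro x ⟨J, hJ, hc, hx⟩
    simp only [Set.mem_iUnion]
    exact ⟨J, Finset.mem_powersetCard.2 ⟨hJ, hc⟩, fun i hi => hx i hi⟩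
  refine (measure_mono hsub).trans ((measure_biUnion_finset_le _ _).trans ?_)
  have h1 : ∀ J ∈ s.powersetCard R, Measure.infinitePi μ ((J : Set ι).pi t) ≤
      ENNReal.ofReal (∏ i ∈ J, p i) := by
    intro J hJ
    rw [Measure.infinitePi_pi _ fun i _ => ht i, ENNReal.ofReal_prod_of_nonneg fun i _ => hp i]
    exact Finset.prod_le_prod' fun i hi => hμ i ((Finset.mem_powersetCard.1 hJ).1 hi)
  refine (Finset.sum_le_sum h1).trans ?_
  rw [← ENNReal.ofReal_sum_of_nonneg fun J _ => Finset.prod_nonneg fun i _ => hp i]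
  refine ENNReal.ofReal_le_ofReal ?_
  -- Weighted by e^R, the products over R-element sets are among the terms of the expanded product ∏
  -- (1 + e p_i); dividing by e^R yields the factor exp(-R).
  have h2 : ∑ J ∈ s.powersetCard R, Real.exp 1 ^ R * ∏ i ∈ J, p i ≤
      ∏ i ∈ s, (1 + Real.exp 1 * p i) := by
    rw [Finset.prod_one_add]
    refine (Finset.sum_le_sum fun J hJ => ?_).trans (Finset.sum_le_sum_of_subset_of_nonneg
      (fun J hJ => Finset.mem_powerset.2 (Finset.mem_powersetCard.1 hJ).1) fun J _ _ =>
        Finset.prod_nonneg fun i _ => mul_nonneg (Real.exp_pos _).le (hp i))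
    rw [Finset.prod_mul_distrib, Finset.prod_const, (Finset.mem_powersetCard.1 hJ).2]
  have h3 : ∏ i ∈ s, (1 + Real.exp 1 * p i) ≤ Real.exp (Real.exp 1 * ∑ i ∈ s, p i) := by
    rw [Finset.mul_sum, Real.exp_sum]
    refine Finset.prod_le_prod (fun i _ => ?_) fun i _ => ?_
    · have := mul_nonneg (Real.exp_pos 1).le (hp i)
      linarith
    · linarith [Real.add_one_le_exp (Real.exp 1 * p i)]
  rw [← Finset.mul_sum, ← Real.exp_nat_mul, mul_one] at h2
  rw [Real.exp_sub, le_div_iff₀ (Real.exp_pos _), mul_comm]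
  exact h2.trans h3

/-! ### Rates -/

lemma log_natCast_pos {n : ℕ} (hn : 2 ≤ n) : 0 < Real.log n :=
  Real.log_pos (by exact_mod_cast (by omega : 1 < n))

lemma log_two_le_log_natCast {n : ℕ} (hn : 2 ≤ n) : Real.log 2 ≤ Real.log n :=
  Real.log_le_log (by norm_num) (by exact_mod_cast hn)

lemma logRate_pos (t : ℝ) {n : ℕ} (hn : 2 ≤ n) : 0 < logRate t n := by
  have := log_natCast_pos hn
  have hn0 : (0 : ℝ) < n := by exact_mod_cast (by omega : 0 < n)
  unfold logRate
  positivity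

lemma logRate_sq (t : ℝ) {n : ℕ} (hn : 2 ≤ n) :
    logRate t n ^ 2 = Real.log n ^ (2 * t) / n := by
  have h := log_natCast_pos hn
  rw [logRate, mul_pow, div_pow, Real.sq_sqrt (Nat.cast_nonneg n), mul_comm 2 t,
    Real.rpow_mul h.le, Real.rpow_two]
  ring

lemma mul_logRate_sq (t : ℝ) {n : ℕ} (hn : 2 ≤ n) :
    (n : ℝ) * logRate t n ^ 2 = Real.log n ^ (2 * t) := by
  have hn0 : (n : ℝ) ≠ 0 := by exact_mod_cast (by omega : n ≠ 0)
  rw [logRate_sq t hn]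
  field_simp

/-- The constant is needed because log 2 < 1, so powers of log n are not monotone in the exponent at
n = 2. -/
lemma log_rpow_le_mul_log_rpow {p r : ℝ} (hpr : p ≤ r) :
    ∃ D : ℝ, 0 < D ∧ ∀ n : ℕ, 2 ≤ n → Real.log n ^ p ≤ D * Real.log n ^ r := by
  have h2 : 0 < Real.log 2 := Real.log_pos (by norm_num)
  refine ⟨Real.log 2 ^ (p - r), by positivity, fun n hn => ?_⟩
  have h := log_natCast_pos hn
  have e : Real.log n ^ p = Real.log n ^ (p - r) * Real.log n ^ r := by
    rw [← Real.rpow_add h]; congr 1; ring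
  rw [e]
  gcongr ?_ * _
  exact Real.rpow_le_rpow_of_nonpos h2 (log_two_le_log_natCast hn) (by linarith)

lemma uSeq_pos (e : ℕ → ℝ) {n : ℕ} (hn : 2 ≤ n) : 0 < uSeq e n := by
  have := log_natCast_pos hn
  unfold uSeq
  split_ifs
  · exact one_pos
  · positivity

lemma uSeq_le (e : ℕ → ℝ) {n : ℕ} (hn : 2 ≤ n) : uSeq e n ≤ (n : ℝ) ^ 2 := by
  have h := log_natCast_pos hn
  have hn1 : (1 : ℝ) ≤ n := by exact_mod_cast (by omega : 1 ≤ n)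
  unfold uSeq
  split_ifs
  · exact one_le_pow₀ hn1
  · calc Real.log n ^ (3 / 2 : ℝ) ≤ (n : ℝ) ^ (3 / 2 : ℝ) := by
          gcongr
          exact Real.log_le_self (by linarith)
      _ ≤ (n : ℝ) ^ (2 : ℝ) := Real.rpow_le_rpow_of_exponent_le hn1 (by norm_num)
      _ = _ := by norm_num

/-- The bound is crude on purpose: it covers both cases of u_n, and polynomially small tolerances
cost only a multiple of log n in the exponent. -/
lemma le_logRate_sq_div_uSeq {t : ℝ} (ht : 0 ≤ t) (e : ℕ → ℝ) {n : ℕ} (hn : 2 ≤ n) :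
    Real.log 2 ^ (2 * t) / (n : ℝ) ^ 3 ≤ logRate t n ^ 2 / uSeq e n := by
  have hn0 : (0 : ℝ) < n := by exact_mod_cast (by omega : 0 < n)
  have h2 : 0 < Real.log 2 := Real.log_pos (by norm_num)
  have hl : Real.log 2 ^ (2 * t) ≤ Real.log n ^ (2 * t) :=
    Real.rpow_le_rpow h2.le (log_two_le_log_natCast hn) (by linarith)
  rw [logRate_sq t hn, div_div]
  have hu := uSeq_pos e hn
  calc Real.log 2 ^ (2 * t) / (n : ℝ) ^ 3 = Real.log 2 ^ (2 * t) / (n * (n : ℝ) ^ 2) := by ring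
    _ ≤ Real.log n ^ (2 * t) / (n * uSeq e n) := by
        gcongr
        exact uSeq_le e hn

lemma le_logRate_sq {t : ℝ} (ht : 0 ≤ t) {n : ℕ} (hn : 2 ≤ n) :
    Real.log 2 ^ (2 * t) / (n : ℝ) ^ 3 ≤ logRate t n ^ 2 := by
  have hn1 : (1 : ℝ) ≤ n := by exact_mod_cast (by omega : 1 ≤ n)
  have h2 : 0 < Real.log 2 := Real.log_pos (by norm_num)
  have hl : Real.log 2 ^ (2 * t) ≤ Real.log n ^ (2 * t) :=
    Real.rpow_le_rpow h2.le (log_two_le_log_natCast hn) (by linarith)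
  rw [logRate_sq t hn]
  have : (n : ℝ) ≤ (n : ℝ) ^ 3 := le_self_pow₀ hn1 (by norm_num)
  gcongr

/-! ### Series over the positive integers -/

lemma one_le_pnat (l : ℕ+) : (1 : ℝ) ≤ (l : ℝ) := by exact_mod_cast l.pos

lemma summable_pnat_rpow {p : ℝ} (hp : 1 < p) : Summable fun l : ℕ+ => (l : ℝ) ^ (-p) :=
  (Real.summable_nat_rpow.2 (by linarith : -p < -1)).comp_injective PNat.coe_injective

lemma rpow_le_mul_exp {s b y : ℝ} (hs : 0 < s) (hb : 0 < b) (hy : 0 ≤ y) :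
    y ^ s ≤ (s / b) ^ s * Real.exp (b * y) := by
  have h1 : y ≤ s / b * Real.exp (b * y / s) := by
    have h2 := Real.add_one_le_exp (b * y / s)
    have h3 : y = s / b * (b * y / s) := by field_simp
    calc y = s / b * (b * y / s) := h3
      _ ≤ _ := by gcongr; linarith
  calc y ^ s ≤ (s / b * Real.exp (b * y / s)) ^ s := by gcongr
    _ = (s / b) ^ s * Real.exp (b * y) := by
        rw [Real.mul_rpow (by positivity) (Real.exp_pos _).le, ← Real.exp_mul]
        congr 2
        field_simp

lemma summable_pnat_rpow_mul_exp {p b m : ℝ} (hp : 0 ≤ p) (hb : 0 < b) (hm : 0 < m) :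
    Summable fun l : ℕ+ => (l : ℝ) ^ p * Real.exp (-b * (l : ℝ) ^ m) := by
  -- This exponent turns powers of l^m into l^{p+2}, so that the exponential beats l^p with l^{-2}
  -- to spare.
  have hs : 0 < (p + 2) / m := by positivity
  refine Summable.of_nonneg_of_le (fun l => by positivity) (fun l => ?_)
    ((summable_pnat_rpow (p := 2) (by norm_num)).mul_left (((p + 2) / m / b) ^ ((p + 2) / m)))
  have hl : (0 : ℝ) < l := by exact_mod_cast l.pos
  have h := rpow_le_mul_exp hs hb (Real.rpow_nonneg hl.le m)
  rw [← Real.rpow_mul hl.le, mul_div_cancel₀ _ hm.ne'] at h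
  have e : (l : ℝ) ^ p = (l : ℝ) ^ (-2 : ℝ) * (l : ℝ) ^ (p + 2) := by
    rw [← Real.rpow_add hl]; congr 1; ring
  rw [e]
  calc (l : ℝ) ^ (-2 : ℝ) * (l : ℝ) ^ (p + 2) * Real.exp (-b * (l : ℝ) ^ m)
      ≤ (l : ℝ) ^ (-2 : ℝ) * (((p + 2) / m / b) ^ ((p + 2) / m) * Real.exp (b * (l : ℝ) ^ m)) *
          Real.exp (-b * (l : ℝ) ^ m) := by gcongr
    _ = ((p + 2) / m / b) ^ ((p + 2) / m) * (l : ℝ) ^ (-2 : ℝ) *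
          (Real.exp (b * (l : ℝ) ^ m) * Real.exp (-b * (l : ℝ) ^ m)) := by ring
    _ = _ := by rw [← Real.exp_add]; simp

/-! ### Prior mass of neighbourhoods of the true transition matrix -/

lemma measurable_simplexChart (k : ℕ) [NeZero k] :
    Measurable (fun (v : {j : Fin k // j ≠ 0} → ℝ) (j : Fin k) =>
      if h : j ≠ 0 then v ⟨j, h⟩ else 1 - ∑ i, v i) := by
  refine measurable_pi_lambda _ fun j => ?_
  by_cases h : j ≠ 0
  · simp only [dif_pos h]
    exact measurable_pi_apply _
  · simp only [dif_neg h]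
    fun_prop

lemma sum_simplexChart {k : ℕ} [NeZero k] (u : Fin k → ℝ) :
    ∑ j, u j = u 0 + ∑ i : {j : Fin k // j ≠ 0}, u i := by
  rw [← Finset.add_sum_erase Finset.univ u (Finset.mem_univ 0)]
  congr 1
  refine (Finset.sum_subtype _ (fun x => ?_) u)
  simp

instance isFiniteMeasure_simplexLebesgue (k : ℕ) [NeZero k] :
    IsFiniteMeasure (simplexLebesgue k) := by
  constructor
  rw [simplexLebesgue, Measure.restrict_apply_univ,
    Measure.map_apply (measurable_simplexChart k) (isClosed_stdSimplex ℝ (Fin k)).measurableSet]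
  refine (measure_mono (t := Set.Icc (0 : {j : Fin k // j ≠ 0} → ℝ) 1) ?_).trans_lt
    isCompact_Icc.measure_lt_top
  intro v hv
  have h : ∀ i : {j : Fin k // j ≠ 0}, 0 ≤ v i ∧ v i ≤ 1 := by
    intro i
    have h0 := hv.1 i
    have h1 := (mem_Icc_of_mem_stdSimplex hv i).2
    simp only [dif_pos i.2] at h0 h1
    exact ⟨h0, h1⟩
  exact ⟨fun i => (h i).1, fun i => (h i).2⟩

/-- Moving the free coordinates by at most r/k moves the dependent coordinate, which is 1 minus
their sum, by at most r. The condition r ≤ q keeps all coordinates non-negative, so a full cube in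
the chart stays inside the simplex. -/
lemma le_simplexLebesgue_closedBall {k : ℕ} [NeZero k] {u : Fin k → ℝ} {q r : ℝ}
    (hu : u ∈ stdSimplex ℝ (Fin k)) (hq : ∀ j, q ≤ u j) (hr : 0 < r) (hrq : r ≤ q) :
    ENNReal.ofReal ((2 * (r / k)) ^ Fintype.card {j : Fin k // j ≠ 0}) ≤
      simplexLebesgue k (Metric.closedBall u r) := by
  have hk : (0 : ℝ) < k := by exact_mod_cast Nat.pos_of_ne_zero (NeZero.ne k)
  have hk1 : (1 : ℝ) ≤ k := by exact_mod_cast Nat.pos_of_ne_zero (NeZero.ne k)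
  have hrk : 0 < r / k := by positivity
  rw [simplexLebesgue, Measure.restrict_apply measurableSet_closedBall,
    Measure.map_apply (measurable_simplexChart k)
      (measurableSet_closedBall.inter (isClosed_stdSimplex ℝ (Fin k)).measurableSet)]
  calc ENNReal.ofReal ((2 * (r / k)) ^ Fintype.card {j : Fin k // j ≠ 0})
      = volume (Metric.closedBall (fun i : {j : Fin k // j ≠ 0} => u i) (r / k)) := by
        rw [Real.volume_pi_closedBall _ hrk.le]
    _ ≤ _ := by
        refine measure_mono fun v hv => ?_
        rw [Metric.mem_closedBall, dist_pi_le_iff hrk.le] at hv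
        have hv' : ∀ i, |v i - u i| ≤ r / k := fun i => by
          rw [← Real.dist_eq]; exact hv i
        have hrk1 : r / k ≤ r := div_le_self hr.le hk1
        have hsum : |∑ i, v i - ∑ i : {j : Fin k // j ≠ 0}, u i| ≤ r := by
          rw [← Finset.sum_sub_distrib]
          refine (Finset.abs_sum_le_sum_abs _ _).trans
            ((Finset.sum_le_sum fun i _ => hv' i).trans ?_)
          rw [Finset.sum_const, nsmul_eq_mul, Finset.card_univ]
          have hc : (Fintype.card {j : Fin k // j ≠ 0} : ℝ) ≤ k := by
            exact_mod_cast (Fintype.card_subtype_le _).trans (by simp)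
          calc _ ≤ (k : ℝ) * (r / k) := by gcongr
            _ = r := by field_simp
        have hu0 : u 0 = 1 - ∑ i : {j : Fin k // j ≠ 0}, u i := by
          have := hu.2
          rw [sum_simplexChart] at this
          linarith
        refine ⟨?_, ?_, ?_⟩
        · rw [Metric.mem_closedBall, dist_pi_le_iff hr.le]
          intro j
          rw [Real.dist_eq]
          by_cases h : j ≠ 0
          · simp only [dif_pos h]
            exact (hv' ⟨j, h⟩).trans hrk1
          · simp only [dif_neg h]
            rw [not_not.1 h, hu0, abs_sub_comm]
            convert hsum using 2
            ring
        · intro j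
          by_cases h : j ≠ 0
          · simp only [dif_pos h]
            have h1 := (abs_le.1 (hv' ⟨j, h⟩)).1
            have h2 := hq j
            simp only at h1
            linarith
          · simp only [dif_neg h]
            have h1 := (abs_le.1 hsum).2
            have h2 := hq 0
            linarith
        · rw [sum_simplexChart]
          have : ∑ x : {j : Fin k // j ≠ 0},
              (if h : (x : Fin k) ≠ 0 then v ⟨x, h⟩ else 1 - ∑ i, v i) = ∑ x, v x :=
            Finset.sum_congr rfl fun x _ => by rw [dif_pos x.2]
          rw [this]
          simp

lemma ae_transitionLebesgue (k : ℕ) [NeZero k] :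
    ∀ᵐ Q ∂transitionLebesgue k, Q ∈ transitionMatrices k 0 := by
  have h : ∀ i : Fin k, ∀ᵐ Q ∂transitionLebesgue k, Q i ∈ stdSimplex ℝ (Fin k) := by
    intro i
    refine (Measure.quasiMeasurePreserving_eval (μ := fun _ : Fin k => simplexLebesgue k) i).ae ?_
    exact ae_restrict_mem (isClosed_stdSimplex ℝ (Fin k)).measurableSet
  filter_upwards [ae_all_iff.2 h] with Q hQ i
  exact ⟨hQ i, fun j => (hQ i).1 j⟩

lemma exists_le_prior_closedBall {k : ℕ} [NeZero k] {Q' : Fin k → Fin k → ℝ} {q : ℝ} (hq : 0 < q)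
    (hQ' : Q' ∈ transitionMatrices k q) (P : Measure (Fin k → Fin k → ℝ))
    [IsProbabilityMeasure P] (hQ0 : AssumptionQ0 P Q') :
    ∃ b : ℝ, 0 < b ∧ ∃ p : ℕ, ∀ r : ℝ, 0 < r → r ≤ 1 →
      b * r ^ p ≤ P.real {Q | ‖Q - Q'‖ ≤ r} := by
  obtain ⟨πq, -, -, hP, hpos, hcont⟩ := hQ0
  set D : ℝ := ∏ i, πq (Q' i) with hD
  have hev : ∀ᶠ Q in 𝓝[transitionMatrices k 0] Q', D / 2 < ∏ i, πq (Q i) :=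
    hcont.eventually (lt_mem_nhds (half_lt_self hpos))
  obtain ⟨ε, hε, hball⟩ := Metric.mem_nhdsWithin_iff.1 hev
  set r₀ : ℝ := min (min (ε / 2) q) 1 with hr₀
  have hr₀0 : 0 < r₀ := lt_min (lt_min (by linarith) hq) one_pos
  have hr₀1 : r₀ ≤ 1 := min_le_right _ _
  have hr₀q : r₀ ≤ q := (min_le_left _ _).trans (min_le_right _ _)
  have hr₀ε : r₀ < ε := ((min_le_left _ _).trans (min_le_left _ _)).trans_lt (by linarith)
  have hk : (0 : ℝ) < k := by exact_mod_cast Nat.pos_of_ne_zero (NeZero.ne k)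
  set κ := Fintype.card {j : Fin k // j ≠ 0}
  refine ⟨D / 2 * (2 * (r₀ / k)) ^ (κ * k), by positivity, κ * k, fun r hr hr1 => ?_⟩
  -- Shrinking every radius by the fixed factor r₀ keeps the ball where the density exceeds D / 2,
  -- uniformly in r ≤ 1, at the price of a constant.
  set ρ := r * r₀ with hρ
  have hρ0 : 0 < ρ := by positivity
  have hρr : ρ ≤ r := mul_le_of_le_one_right hr.le hr₀1
  have hρr₀ : ρ ≤ r₀ := mul_le_of_le_one_left hr₀0.le hr1
  have key : ENNReal.ofReal (D / 2 * (2 * (ρ / k)) ^ (κ * k)) ≤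
      P (Metric.closedBall Q' ρ) := by
    rw [hP, withDensity_apply _ measurableSet_closedBall]
    calc ENNReal.ofReal (D / 2 * (2 * (ρ / k)) ^ (κ * k))
        = ENNReal.ofReal (D / 2) * ∏ i : Fin k, ENNReal.ofReal ((2 * (ρ / k)) ^ κ) := by
          rw [ENNReal.ofReal_mul (by positivity), Finset.prod_const, Finset.card_univ,
            Fintype.card_fin, ← ENNReal.ofReal_pow (by positivity), pow_mul]
      _ ≤ ENNReal.ofReal (D / 2) *
            ∏ i : Fin k, simplexLebesgue k (Metric.closedBall (Q' i) ρ) := by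
          gcongr with i
          exact le_simplexLebesgue_closedBall (hQ' i).1 (hQ' i).2 hρ0 (hρr₀.trans hr₀q)
      _ = ENNReal.ofReal (D / 2) * transitionLebesgue k (Metric.closedBall Q' ρ) := by
          rw [closedBall_pi Q' hρ0.le, transitionLebesgue, Measure.pi_pi]
      _ = ∫⁻ _ in Metric.closedBall Q' ρ, ENNReal.ofReal (D / 2) ∂transitionLebesgue k := by
          rw [setLIntegral_const]
      _ ≤ _ := by
          refine lintegral_mono_ae ?_
          filter_upwards [ae_restrict_mem measurableSet_closedBall,
            ae_restrict_of_ae (ae_transitionLebesgue k)] with Q hQ hQ2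
          refine ENNReal.ofReal_le_ofReal (le_of_lt (hball ⟨?_, hQ2⟩))
          exact Metric.mem_ball.2 ((Metric.mem_closedBall.1 hQ).trans_lt (hρr₀.trans_lt hr₀ε))
  have hsub : Metric.closedBall Q' ρ ⊆ {Q | ‖Q - Q'‖ ≤ r} := fun Q hQ => by
    rw [mem_closedBall_iff_norm] at hQ
    exact hQ.trans hρr
  calc D / 2 * (2 * (r₀ / k)) ^ (κ * k) * r ^ (κ * k) = D / 2 * (2 * (ρ / k)) ^ (κ * k) := by
        rw [mul_assoc, ← mul_pow, hρ]
        congr 2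
        ring
    _ ≤ P.real (Metric.closedBall Q' ρ) :=
        (ENNReal.ofReal_le_iff_le_toReal (measure_ne_top _ _)).1 key
    _ ≤ _ := measureReal_mono hsub

lemma exists_prior_rate {k : ℕ} [NeZero k] {Q' : Fin k → Fin k → ℝ} {q : ℝ} (hq : 0 < q)
    (hQ' : Q' ∈ transitionMatrices k q) (P : Measure (Fin k → Fin k → ℝ))
    [IsProbabilityMeasure P] (hQ0 : AssumptionQ0 P Q') {t : ℝ} (ht : 1 ≤ 2 * t) :
    ∃ CQ : ℝ, 0 < CQ ∧ ∃ b : ℝ, 0 < b ∧ ∀ n : ℕ, 2 ≤ n →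
      b * Real.exp (-CQ * n * logRate t n ^ 2) ≤
        P.real {Q | ‖Q - Q'‖ ≤ logRate t n / √(uSeq (logRate t) n)} := by
  obtain ⟨b, hb, p, hbp⟩ := exists_le_prior_closedBall hq hQ' P hQ0
  obtain ⟨D, hD, hlog⟩ := log_rpow_le_mul_log_rpow ht
  have h2 : 0 < Real.log 2 := Real.log_pos (by norm_num)
  have h21 : Real.log 2 ≤ 1 := by linarith [Real.log_two_lt_d9]
  set a : ℝ := Real.log 2 ^ t with ha
  have ha0 : 0 < a := by positivity
  have ha1 : a ≤ 1 := Real.rpow_le_one h2.le h21 (by linarith)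
  refine ⟨2 * p * D + 1, by positivity, b * a ^ p, by positivity, fun n hn => ?_⟩
  have hn1 : (1 : ℝ) ≤ n := by exact_mod_cast (by omega : 1 ≤ n)
  have hn0 : (0 : ℝ) < n := by linarith
  have hln := log_natCast_pos hn
  -- The power 2 suffices since r² is of order n^{-4}, below the n^{-3} lower bound for ε̃_n²/u_n.
  set r : ℝ := a / (n : ℝ) ^ 2 with hr
  have hr0 : 0 < r := by positivity
  have hr1 : r ≤ 1 := by
    rw [hr, div_le_one (by positivity)]
    exact ha1.trans (one_le_pow₀ hn1)
  have hle : r ≤ logRate t n / √(uSeq (logRate t) n) := by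
    have hu := uSeq_pos (logRate t) hn
    have hlr := logRate_pos t hn
    refine le_of_sq_le_sq ?_ (by positivity)
    rw [div_pow (logRate t n), Real.sq_sqrt hu.le]
    refine le_trans ?_ (le_logRate_sq_div_uSeq (by linarith) _ hn)
    rw [hr, div_pow, ha, ← Real.rpow_natCast, ← Real.rpow_mul h2.le, ← pow_mul]
    have : (n : ℝ) ^ 3 ≤ (n : ℝ) ^ (2 * 2) := pow_le_pow_right₀ hn1 (by norm_num)
    push_cast
    rw [mul_comm t 2]
    gcongr
  have hexp : Real.exp (-(2 * p * D + 1) * n * logRate t n ^ 2) ≤ (1 / (n : ℝ) ^ 2) ^ p := by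
    have e : (1 / (n : ℝ) ^ 2) ^ p = Real.exp (-(2 * p) * Real.log n) := by
      rw [one_div, inv_pow, ← pow_mul, neg_mul, Real.exp_neg]
      congr 1
      rw [mul_comm (2 * (p : ℝ)), ← Real.rpow_def_of_pos hn0, ← Real.rpow_natCast]
      push_cast
      rfl
    rw [e, mul_assoc, mul_logRate_sq t hn]
    apply Real.exp_le_exp.2
    have h1 := hlog n hn
    rw [Real.rpow_one] at h1
    have h3 : 0 ≤ Real.log n ^ (2 * t) := by positivity
    have h4 : 2 * (p : ℝ) * Real.log n ≤ 2 * p * (D * Real.log n ^ (2 * t)) := by gcongr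
    nlinarith
  calc b * a ^ p * Real.exp (-(2 * p * D + 1) * n * logRate t n ^ 2)
      ≤ b * a ^ p * (1 / (n : ℝ) ^ 2) ^ p := by gcongr
    _ = b * r ^ p := by rw [mul_assoc, ← mul_pow, hr]; congr 2; ring
    _ ≤ P.real {Q | ‖Q - Q'‖ ≤ r} := hbp r hr0 hr1
    _ ≤ _ := measureReal_mono fun Q hQ => le_trans hQ hle

/-! ### Densities that are concentrated on few atoms -/

lemma Density.nonneg (f : Density) (l : ℕ+) : 0 ≤ f l := f.2.1 l

lemma Density.le_one (f : Density) (l : ℕ+) : f l ≤ 1 :=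
  le_hasSum f.2.2 l fun j _ => f.2.1 j

lemma Density.measurable_apply (l : ℕ+) : Measurable fun f : Density => f l :=
  (measurable_pi_apply l).comp measurable_subtype_coe

lemma normalise_apply {γ : ℕ+ → ℝ} (h0 : ∀ l, 0 ≤ γ l) (h1 : 0 < ∑' m, γ m) (l : ℕ+) :
    normalise γ l = γ l / ∑' m, γ m := by
  unfold normalise
  rw [dif_pos ⟨h0, h1⟩]

/-- The densities that put mass at least `1 - τ` on some `R` (not necessarily distinct) elements of
`{1, …, L}`. -/
def sparseDensities (R : ℕ) (L : ℕ+) (τ : ℝ) : Set Density :=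
  {f | ∃ v : Fin R → Finset.Icc (1 : ℕ+) L,
    1 - τ ≤ ∑ l ∈ Finset.univ.image (fun r => (v r : ℕ+)), f l}

lemma measurableSet_sparseDensities (R : ℕ) (L : ℕ+) (τ : ℝ) :
    MeasurableSet (sparseDensities R L τ) := by
  have : sparseDensities R L τ = ⋃ v : Fin R → Finset.Icc (1 : ℕ+) L,
      {f : Density | 1 - τ ≤ ∑ l ∈ Finset.univ.image (fun r => (v r : ℕ+)), f l} := by
    ext f; simp [sparseDensities]
  rw [this]
  exact MeasurableSet.iUnion fun v => measurableSet_le measurable_const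
    (Finset.measurable_sum _ fun l _ => Density.measurable_apply l)

lemma hasSum_indicator_finset (I : Finset ℕ+) (u : ℕ+ → ℝ) :
    HasSum (fun l => if l ∈ I then u l else 0) (∑ l ∈ I, u l) := by
  have h : HasSum (fun l => if l ∈ I then u l else 0) (∑ l ∈ I, if l ∈ I then u l else 0) :=
    hasSum_sum_of_ne_finset_zero fun b hb => if_neg hb
  rwa [Finset.sum_congr rfl fun l hl => if_pos hl] at h

/-! ### Covering numbers -/

/-- The centres must belong to A, so one representative is taken from each non-empty fibre of the
code c on A. -/
lemma coveringNumber_le_card {X ι : Type*} [Fintype ι] {ε : ℝ} {A : Set X} {D : X → X → ℝ}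
    (c : X → ι) (hc : ∀ x ∈ A, ∀ y ∈ A, c x = c y → D x y < ε) :
    coveringNumber ε A D ≤ Fintype.card ι := by
  classical
  have hch : ∀ i : c '' A, ∃ x ∈ A, c x = i := fun i => i.2
  choose s hsA hs using hch
  refine (iInf₂_le (Set.range s) (by rintro _ ⟨i, rfl⟩; exact hsA i)).trans
    ((iInf_le _ fun x hx => ⟨s ⟨c x, x, hx, rfl⟩, ⟨_, rfl⟩,
      hc x hx _ (hsA _) (hs ⟨c x, x, hx, rfl⟩).symm⟩).trans ?_)
  rw [← Set.image_univ]
  refine (Set.encard_image_le _ _).trans ?_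
  rw [Set.encard_univ, ENat.card_eq_coe_fintype_card]
  exact_mod_cast Fintype.card_subtype_le _

/-- Off I, |f - g| ≤ f + g, and each density has mass at most τ there. -/
lemma tsum_abs_sub_le {f g : Density} {I : Finset ℕ+} {τ δ : ℝ} (hf : 1 - τ ≤ ∑ l ∈ I, f l)
    (hg : 1 - τ ≤ ∑ l ∈ I, g l) (hfg : ∀ l ∈ I, |f l - g l| ≤ δ) :
    ∑' l, |f l - g l| ≤ 2 * τ + I.card * δ := by
  have hs : HasSum (fun l => f l + g l - (if l ∈ I then f l + g l else 0) +
      (if l ∈ I then δ else 0)) (1 + 1 - ∑ l ∈ I, (f l + g l) + ∑ l ∈ I, δ) :=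
    ((f.2.2.add g.2.2).sub (hasSum_indicator_finset I _)).add (hasSum_indicator_finset I _)
  have hle : ∀ l, |f l - g l| ≤ f l + g l - (if l ∈ I then f l + g l else 0) +
      (if l ∈ I then δ else 0) := by
    intro l
    split_ifs with h
    · linarith [hfg l h]
    · have h1 := f.nonneg l
      have h2 := g.nonneg l
      rw [abs_le]
      constructor <;> linarith
  have hsum : Summable fun l => |f l - g l| :=
    Summable.of_nonneg_of_le (fun l => abs_nonneg _) hle hs.summable
  refine (hsum.tsum_le_tsum hle hs.summable).trans ?_
  rw [hs.tsum_eq, Finset.sum_add_distrib, Finset.sum_const, nsmul_eq_mul]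
  linarith

/-- Each component is encoded by its R atoms and its masses there rounded down to multiples of 1/M.
Equal codes mean an L₁ distance of at most 2τ + R/M; masses off the atoms need no encoding. -/
lemma coveringNumber_sparseDensities_le {k : ℕ} [NeZero k] (R : ℕ) (L : ℕ+) (M : ℕ) (hM : 0 < M)
    {τ ε : ℝ} (hε : 2 * τ + R / M < ε) :
    coveringNumber ε {f : Fin k → Density | ∀ j, f j ∈ sparseDensities R L τ} emissionDist ≤
      (((L : ℕ) * (M + 1)) ^ (R * k) : ℕ) := by
  classical
  have hLpos : Nonempty (Finset.Icc (1 : ℕ+) L) := ⟨⟨1, by simp⟩⟩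
  let V := Fin R → Finset.Icc (1 : ℕ+) L
  have hv : ∀ f : Density, ∃ v : V, f ∈ sparseDensities R L τ →
      1 - τ ≤ ∑ l ∈ Finset.univ.image (fun r => (v r : ℕ+)), f l := by
    intro f
    by_cases h : f ∈ sparseDensities R L τ
    · obtain ⟨v, hv⟩ := h
      exact ⟨v, fun _ => hv⟩
    · exact ⟨fun _ => Classical.arbitrary _, fun h' => absurd h' h⟩
  choose v hv using hv
  have hfl : ∀ (f : Density) (l : ℕ+), ⌊(M : ℝ) * f l⌋₊ < M + 1 := by
    intro f l
    rw [Nat.lt_succ_iff]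
    refine Nat.floor_le_of_le ?_
    exact mul_le_of_le_one_right (Nat.cast_nonneg M) (f.le_one l)
  let c : (Fin k → Density) → (Fin k → V × (Fin R → Fin (M + 1))) := fun f j =>
    (v (f j), fun r => ⟨⌊(M : ℝ) * f j (v (f j) r)⌋₊, hfl _ _⟩)
  have hM' : (0 : ℝ) < M := by exact_mod_cast hM
  have key := coveringNumber_le_card (ε := ε) (D := emissionDist)
    (A := {f : Fin k → Density | ∀ j, f j ∈ sparseDensities R L τ}) c (by
    intro f hf g hg hcfg
    refine lt_of_le_of_lt (ciSup_le fun j => ?_) hε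
    have h1 : v (f j) = v (g j) := congrArg Prod.fst (congrFun hcfg j)
    have h2 := hv (f j) (hf j)
    have h3 := hv (g j) (hg j)
    rw [← h1] at h3
    have h4 := tsum_abs_sub_le (δ := 1 / M) h2 h3 (by
      intro l hl
      obtain ⟨r, -, rfl⟩ := Finset.mem_image.1 hl
      have h5 := congrFun (congrArg Prod.snd (congrFun hcfg j)) r
      have h6 : ⌊(M : ℝ) * f j (v (f j) r)⌋₊ = ⌊(M : ℝ) * g j (v (f j) r)⌋₊ := by
        have := congrArg Fin.val h5
        simp only [c] at this
        rw [this, h1]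
      have h7 := Nat.floor_le (mul_nonneg hM'.le ((f j).nonneg (v (f j) r)))
      have h8 := Nat.floor_le (mul_nonneg hM'.le ((g j).nonneg (v (f j) r)))
      have h9 := Nat.lt_floor_add_one ((M : ℝ) * f j (v (f j) r))
      have h10 := Nat.lt_floor_add_one ((M : ℝ) * g j (v (f j) r))
      rw [h6] at h7 h9
      rw [abs_le, ← neg_div, div_le_iff₀ hM', le_div_iff₀ hM']
      constructor <;> nlinarith)
    refine h4.trans ?_
    have h11 : ((Finset.univ.image (fun r => (v (f j) r : ℕ+))).card : ℝ) ≤ R := by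
      exact_mod_cast Finset.card_image_le.trans (by simp)
    have : ((Finset.univ.image (fun r => (v (f j) r : ℕ+))).card : ℝ) * (1 / M) ≤ R / M := by
      rw [div_eq_mul_one_div (R : ℝ)]
      gcongr
    linarith)
  refine key.trans (le_of_eq ?_)
  have hcard : Fintype.card (Finset.Icc (1 : ℕ+) L) = L := by
    rw [Fintype.card_coe, PNat.card_Icc]; simp
  simp only [Fintype.card_pi, Fintype.card_prod, Finset.prod_const, Finset.card_univ,
    Fintype.card_fin, V, hcard, ← mul_pow, ← pow_mul]

/-! ### Prior mass of the sparse densities -/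

lemma exists_fin_image_eq {L : ℕ+} {R : ℕ} {J : Finset ℕ+} (hJ : J.Nonempty)
    (hJL : J ⊆ Finset.Icc 1 L) (hR : J.card ≤ R) :
    ∃ v : Fin R → Finset.Icc (1 : ℕ+) L, Finset.univ.image (fun r => (v r : ℕ+)) = J := by
  have hne : Nonempty J := hJ.to_subtype
  obtain ⟨e⟩ := Function.Embedding.nonempty_of_card_le (α := J) (β := Fin R) (by simpa using hR)
  have hs := Function.invFun_surjective e.injective
  refine ⟨fun r => ⟨(Function.invFun e r : J), hJL (Function.invFun e r).2⟩, ?_⟩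
  ext l
  simp only [Finset.mem_image, Finset.mem_univ, true_and]
  constructor
  · rintro ⟨r, rfl⟩
    exact (Function.invFun e r).2
  · intro hl
    obtain ⟨r, hr⟩ := hs ⟨l, hl⟩
    exact ⟨r, by rw [hr]⟩

/-- The weights not exceeding θ l^{-2} have total at most θ ∑ l^{-2} ≤ τ y, and the total of all
weights is at least γ 1 ≥ y. -/
lemma normalise_mem_sparseDensities {γ : ℕ+ → ℝ} {y θ τ : ℝ} {R : ℕ} {L : ℕ+} (hθ : 0 ≤ θ)
    (h0 : ∀ l, 0 ≤ γ l) (hy : 0 < y) (h1 : y ≤ γ 1) (hL : ∀ l, L < l → γ l ≤ θ * (l : ℝ) ^ (-2 : ℝ))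
    (hR : ((Finset.Icc 1 L).filter fun l : ℕ+ => θ * (l : ℝ) ^ (-2 : ℝ) < γ l).card < R)
    (hτ : θ * ∑' l : ℕ+, (l : ℝ) ^ (-2 : ℝ) ≤ τ * y) :
    normalise γ ∈ sparseDensities R L τ := by
  -- Adding the atom 1 makes J non-empty; the strict inequality in `hR` leaves room for it.
  set J := insert 1 ((Finset.Icc 1 L).filter fun l : ℕ+ => θ * (l : ℝ) ^ (-2 : ℝ) < γ l) with hJ
  have hJL : J ⊆ Finset.Icc 1 L := by
    intro l hl
    rcases Finset.mem_insert.1 hl with h | h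
    · rw [h]; simp
    · exact (Finset.mem_filter.1 h).1
  obtain ⟨v, hv⟩ := exists_fin_image_eq ⟨1, Finset.mem_insert_self _ _⟩ hJL
    ((Finset.card_insert_le _ _).trans hR)
  have hsum2 := summable_pnat_rpow (p := 2) (by norm_num)
  have hb : HasSum (fun l : ℕ+ => θ * (l : ℝ) ^ (-2 : ℝ) + if l ∈ J then γ l else 0)
      (θ * ∑' l : ℕ+, (l : ℝ) ^ (-2 : ℝ) + ∑ l ∈ J, γ l) :=
    (hsum2.hasSum.mul_left θ).add (hasSum_indicator_finset J γ)
  have hle : ∀ l, γ l ≤ θ * (l : ℝ) ^ (-2 : ℝ) + if l ∈ J then γ l else 0 := by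
    intro l
    have hp : 0 ≤ θ * (l : ℝ) ^ (-2 : ℝ) := by positivity
    split_ifs with h
    · linarith
    · rw [add_zero]
      by_contra hc
      rw [not_le] at hc
      by_cases hlL : L < l
      · exact absurd (hL l hlL) (not_le.2 hc)
      · exact h (Finset.mem_insert_of_mem (Finset.mem_filter.2
          ⟨Finset.mem_Icc.2 ⟨one_le, not_lt.1 hlL⟩, hc⟩))
  have hs : Summable γ := Summable.of_nonneg_of_le h0 hle hb.summable
  have hT : y ≤ ∑' m, γ m := h1.trans (hs.le_tsum 1 fun j _ => h0 j)
  have hT0 : 0 < ∑' m, γ m := hy.trans_le hT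
  refine ⟨v, ?_⟩
  rw [hv]
  simp only [normalise_apply h0 hT0]
  rw [← Finset.sum_div, le_div_iff₀ hT0]
  have h2 := (hs.tsum_le_tsum hle hb.summable).trans (le_of_eq hb.tsum_eq)
  have hτ0 : 0 ≤ τ := by
    have : 0 ≤ θ * ∑' l : ℕ+, (l : ℝ) ^ (-2 : ℝ) :=
      mul_nonneg hθ (tsum_nonneg fun l => by positivity)
    by_contra hc
    nlinarith
  nlinarith

/-- With threshold e^{-t} l^{-2}, failure forces γ 1 < y, or an exceedance beyond L, or at least R
exceedances up to L; the three terms bound these events. Exceedance at l has probability O(t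
l^{-3/2}), so the expected number is O(t) whatever L is, and a Chernoff bound gives the last term.
-/
lemma exists_dirichletProcess_sparseDensities {G : ℕ+ → ℝ} (hP : AssumptionP G) :
    ∃ g D Z : ℝ, 0 < g ∧ 0 < D ∧ 0 < Z ∧ ∀ (t y τ : ℝ) (R : ℕ) (L : ℕ+), 1 ≤ t → 0 < y →
      Z * Real.exp (-t) ≤ τ * y →
      (dirichletProcess G) (sparseDensities R L τ)ᶜ ≤ ENNReal.ofReal
        (D * y ^ g + D * t * (L : ℝ) ^ (-(1 / 4) : ℝ) + Real.exp (D * t - R)) := by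
  obtain ⟨a, A, α, ha, haA, hα, hG⟩ := hP
  have hA : 0 < A := by linarith
  have hGpos : ∀ l, 0 < G l := fun l => by
    have hl : (0 : ℝ) < l := by exact_mod_cast l.pos
    exact lt_of_lt_of_le (by positivity) (hG l).1
  have hG2 : ∀ l : ℕ+, G l ≤ A * (l : ℝ) ^ (-2 : ℝ) := fun l => by
    refine (hG l).2.trans ?_
    gcongr
    · exact one_le_pnat l
  have hGA : ∀ l : ℕ+, G l ≤ A := fun l => by
    refine (hG2 l).trans (mul_le_of_le_one_right hA.le ?_)
    exact Real.rpow_le_one_of_one_le_of_nonpos (one_le_pnat l) (by norm_num)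
  obtain ⟨C, hC, hCg⟩ := exists_gammaLaw_Ioi_le hA
  set Z := ∑' l : ℕ+, (l : ℝ) ^ (-2 : ℝ) with hZ
  have hs2 := summable_pnat_rpow (p := 2) (by norm_num)
  have hs32 := summable_pnat_rpow (p := 3 / 2) (by norm_num)
  have hs54 := summable_pnat_rpow (p := 5 / 4) (by norm_num)
  have hZ0 : 0 < Z := hs2.tsum_pos (fun l => by positivity) 1 (by simp)
  set Z₁ := ∑' l : ℕ+, (l : ℝ) ^ (-(3 / 2) : ℝ) with hZ₁
  set Z₂ := ∑' l : ℕ+, (l : ℝ) ^ (-(5 / 4) : ℝ) with hZ₂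
  have hZ₁0 : 0 ≤ Z₁ := tsum_nonneg fun l => by positivity
  have hZ₂0 : 0 ≤ Z₂ := tsum_nonneg fun l => by positivity
  have hΓ : 0 < Real.Gamma (G 1 + 1) := Real.Gamma_pos_of_pos (by linarith [hGpos 1])
  -- The 5 comes from t + 2 log l ≤ t + 4 √l ≤ 5 t √l, valid for t ≥ 1.
  set E := C * A * 5 with hE
  have hE0 : 0 < E := by positivity
  refine ⟨G 1, 1 / Real.Gamma (G 1 + 1) + E * Z₂ + Real.exp 1 * E * Z₁, Z, hGpos 1,
    by positivity, hZ0, fun t y τ R L ht hy hτ => ?_⟩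
  set θ := Real.exp (-t) with hθ
  have hθ0 : 0 < θ := Real.exp_pos _
  set p : ℕ+ → ℝ := fun l => E * t * (l : ℝ) ^ (-(3 / 2) : ℝ) with hp
  have hp0 : ∀ l, 0 ≤ p l := fun l => by positivity
  have hpl : ∀ l : ℕ+, gammaLaw (G l) (Set.Ioi (θ * (l : ℝ) ^ (-2 : ℝ))) ≤
      ENNReal.ofReal (p l) := by
    intro l
    have hl : (0 : ℝ) < l := by exact_mod_cast l.pos
    have hl1 := one_le_pnat l
    have hlog : -Real.log (θ * (l : ℝ) ^ (-2 : ℝ)) = t + 2 * Real.log l := by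
      rw [Real.log_mul hθ0.ne' (by positivity), hθ, Real.log_exp, Real.log_rpow hl]
      ring
    have hlog0 : 0 ≤ Real.log l := Real.log_nonneg hl1
    refine (hCg (G l) _ (hGpos l) (hGA l) (by positivity) (by rw [hlog]; linarith)).trans
      (ENNReal.ofReal_le_ofReal ?_)
    rw [hlog]
    have h1 : Real.log l ≤ (l : ℝ) ^ (1 / 2 : ℝ) / (1 / 2) :=
      Real.log_le_rpow_div hl.le (by norm_num)
    have h2 : 1 ≤ (l : ℝ) ^ (1 / 2 : ℝ) := Real.one_le_rpow hl1 (by norm_num)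
    have h3 : t + 2 * Real.log l ≤ 5 * t * (l : ℝ) ^ (1 / 2 : ℝ) := by nlinarith
    have h4 : (l : ℝ) ^ (-(3 / 2) : ℝ) = (l : ℝ) ^ (-2 : ℝ) * (l : ℝ) ^ (1 / 2 : ℝ) := by
      rw [← Real.rpow_add hl]; norm_num
    calc C * G l * (t + 2 * Real.log l)
        ≤ C * (A * (l : ℝ) ^ (-2 : ℝ)) * (5 * t * (l : ℝ) ^ (1 / 2 : ℝ)) := by
          gcongr
          exact hG2 l
      _ = p l := by simp only [hp, hE, h4]; ring
  set μ := Measure.infinitePi fun l => gammaLaw (G l) with hμ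
  rw [dirichletProcess, Measure.map_apply measurable_normalise
    (measurableSet_sparseDensities R L τ).compl]
  have hsub : normalise ⁻¹' (sparseDensities R L τ)ᶜ ⊆
      (⋃ l : ℕ+, {γ : ℕ+ → ℝ | γ l ∈ Set.Iio 0}) ∪ ({γ : ℕ+ → ℝ | γ 1 ∈ Set.Iio y} ∪
        ((⋃ l : ℕ+, {γ : ℕ+ → ℝ | L < l ∧ γ l ∈ Set.Ioi (θ * (l : ℝ) ^ (-2 : ℝ))}) ∪
          {γ : ℕ+ → ℝ | ∃ J ⊆ Finset.Icc 1 L, J.card = R ∧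
            ∀ l ∈ J, γ l ∈ Set.Ioi (θ * (l : ℝ) ^ (-2 : ℝ))})) := by
    intro γ hγ
    by_contra hc
    simp only [Set.mem_union, Set.mem_iUnion, Set.mem_ofPred_eq, Set.mem_Iio, Set.mem_Ioi,
      not_or, not_exists, not_and, not_lt] at hc
    obtain ⟨h0, h1, h2, h3⟩ := hc
    refine hγ (normalise_mem_sparseDensities hθ0.le h0 hy h1 h2 ?_ (by rw [mul_comm]; exact hτ))
    by_contra hR
    rw [not_lt] at hR
    obtain ⟨J, hJ, hJR⟩ := Finset.exists_subset_card_eq hR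
    exact h3 J (hJ.trans (Finset.filter_subset _ _)) hJR
      fun l hl => (Finset.mem_filter.1 (hJ hl)).2
  have hneg : μ (⋃ l : ℕ+, {γ : ℕ+ → ℝ | γ l ∈ Set.Iio 0}) = 0 := by
    refine measure_iUnion_null fun l => ?_
    rw [infinitePi_eval_preimage _ l measurableSet_Iio, gammaLaw_Iio_zero (hGpos l)]
  have hfirst : μ {γ : ℕ+ → ℝ | γ 1 ∈ Set.Iio y} ≤
      ENNReal.ofReal (y ^ G 1 / Real.Gamma (G 1 + 1)) := by
    rw [infinitePi_eval_preimage _ 1 measurableSet_Iio]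
    exact gammaLaw_Iio_le (hGpos 1) hy
  have hL0 : (0 : ℝ) < L := by exact_mod_cast L.pos
  have htail : μ (⋃ l : ℕ+, {γ : ℕ+ → ℝ | L < l ∧ γ l ∈ Set.Ioi (θ * (l : ℝ) ^ (-2 : ℝ))}) ≤
      ENNReal.ofReal (E * t * (L : ℝ) ^ (-(1 / 4) : ℝ) * Z₂) := by
    rw [hZ₂, ← tsum_mul_left, ENNReal.ofReal_tsum_of_nonneg (fun l => by positivity)
      (hs54.mul_left _)]
    refine (measure_iUnion_le _).trans (ENNReal.tsum_le_tsum fun l => ?_)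
    by_cases hl : L < l
    · have hl0 : (0 : ℝ) < l := by exact_mod_cast l.pos
      have hLl : (L : ℝ) ≤ l := by exact_mod_cast hl.le
      simp only [hl, true_and]
      rw [infinitePi_eval_preimage _ l measurableSet_Ioi]
      refine (hpl l).trans (ENNReal.ofReal_le_ofReal ?_)
      -- One factor gives decay in L, the other remains summable.
      have h1 : (l : ℝ) ^ (-(3 / 2) : ℝ) = (l : ℝ) ^ (-(1 / 4) : ℝ) * (l : ℝ) ^ (-(5 / 4) : ℝ) := by
        rw [← Real.rpow_add hl0]; norm_num
      have h2 : (l : ℝ) ^ (-(1 / 4) : ℝ) ≤ (L : ℝ) ^ (-(1 / 4) : ℝ) :=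
        Real.rpow_le_rpow_of_nonpos hL0 hLl (by norm_num)
      simp only [hp]
      rw [h1, mul_assoc (E * t)]
      gcongr
    · simp [hl]
  have hcard : μ {γ : ℕ+ → ℝ | ∃ J ⊆ Finset.Icc 1 L, J.card = R ∧
      ∀ l ∈ J, γ l ∈ Set.Ioi (θ * (l : ℝ) ^ (-2 : ℝ))} ≤
      ENNReal.ofReal (Real.exp (Real.exp 1 * ∑ l ∈ Finset.Icc 1 L, p l - R)) :=
    infinitePi_card_le (fun l => gammaLaw (G l))
      (t := fun l : ℕ+ => Set.Ioi (θ * (l : ℝ) ^ (-2 : ℝ))) (fun l => measurableSet_Ioi)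
      (Finset.Icc 1 L) p hp0 (fun l _ => hpl l) R
  refine (measure_mono hsub).trans ((measure_union_le _ _).trans ?_)
  rw [hneg, zero_add]
  refine (measure_union_le _ _).trans ((add_le_add hfirst ((measure_union_le _ _).trans
    (add_le_add htail hcard))).trans ?_)
  rw [← ENNReal.ofReal_add (by positivity) (by positivity),
    ← ENNReal.ofReal_add (by positivity) (by positivity), ← add_assoc]
  refine ENNReal.ofReal_le_ofReal ?_
  have hsump : ∑ l ∈ Finset.Icc 1 L, p l ≤ E * t * Z₁ := by
    rw [hZ₁, ← tsum_mul_left]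
    exact (hs32.mul_left (E * t)).sum_le_tsum _ fun l _ => hp0 l
  refine add_le_add (add_le_add ?_ ?_) (Real.exp_le_exp.2 ?_)
  · have : y ^ G 1 / Real.Gamma (G 1 + 1) = 1 / Real.Gamma (G 1 + 1) * y ^ G 1 := by ring
    rw [this]
    gcongr
    have : 0 ≤ E * Z₂ + Real.exp 1 * E * Z₁ := by positivity
    linarith
  · have : E * t * (L : ℝ) ^ (-(1 / 4) : ℝ) * Z₂ = E * Z₂ * t * (L : ℝ) ^ (-(1 / 4) : ℝ) := by ring
    rw [this]
    gcongr
    have h1 : 0 ≤ Real.exp 1 * E * Z₁ := by positivity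
    have h2 : 0 < 1 / Real.Gamma (G 1 + 1) := by positivity
    linarith
  · refine sub_le_sub_right ?_ _
    have h1 : 0 ≤ E * Z₂ := by positivity
    have h2 : 0 < 1 / Real.Gamma (G 1 + 1) := by positivity
    calc Real.exp 1 * ∑ l ∈ Finset.Icc 1 L, p l ≤ Real.exp 1 * (E * t * Z₁) := by gcongr
      _ = Real.exp 1 * E * Z₁ * t := by ring
      _ ≤ _ := by gcongr; linarith

/-! ### The sieve -/

lemma emissionPrior_compl_le {k : ℕ} {G : ℕ+ → ℝ} {S : Set Density} (hS : MeasurableSet S)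
    {b : ℝ} (hb : 0 ≤ b) (h : dirichletProcess G Sᶜ ≤ ENNReal.ofReal b) :
    (emissionPrior k G).real {f | ∀ j, f j ∈ S}ᶜ ≤ k * b := by
  have hsub : {f : Fin k → Density | ∀ j, f j ∈ S}ᶜ ⊆ ⋃ j, Function.eval j ⁻¹' Sᶜ := by
    intro f hf
    simp only [Set.mem_compl_iff, Set.mem_ofPred_eq, not_forall] at hf
    simpa using hf
  refine ENNReal.toReal_le_of_le_ofReal (by positivity) ?_
  refine (measure_mono hsub).trans ((measure_iUnion_fintype_le _ _).trans ?_)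
  calc ∑ j : Fin k, emissionPrior k G (Function.eval j ⁻¹' Sᶜ)
      = ∑ j : Fin k, dirichletProcess G Sᶜ := by
        refine Finset.sum_congr rfl fun j _ => ?_
        exact (measurePreserving_eval (fun _ : Fin k => dirichletProcess G) j).measure_preimage
          hS.compl.nullMeasurableSet
    _ ≤ ∑ j : Fin k, ENNReal.ofReal b := Finset.sum_le_sum fun _ _ => h
    _ = ENNReal.ofReal (k * b) := by
        rw [Finset.sum_const, Finset.card_univ, Fintype.card_fin, nsmul_eq_mul,
          ENNReal.ofReal_mul (Nat.cast_nonneg k), ENNReal.ofReal_natCast]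

lemma tendsto_log_rpow_atTop {p : ℝ} (hp : 0 < p) :
    Tendsto (fun n : ℕ => Real.log n ^ p) atTop atTop :=
  (tendsto_rpow_atTop hp).comp (Real.tendsto_log_atTop.comp tendsto_natCast_atTop_atTop)

lemma le_exp_div_mul {a x₀ x : ℝ} (ha : 0 ≤ a) (hx₀ : 0 < x₀) (hx : x₀ ≤ x) :
    a ≤ Real.exp (a / x₀ * x) := by
  have h1 : a ≤ a / x₀ * x := by
    calc a = a / x₀ * x₀ := by field_simp
      _ ≤ a / x₀ * x := by gcongr
  linarith [Real.add_one_le_exp (a / x₀ * x)]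

/-- Dividing by the rate costs only a factor exp(O(x)), so thresholds and grids may be as fine as
ε_n. -/
lemma exists_mul_exp_le_logRate {t p : ℝ} (ht : 0 ≤ t) (hp : 1 ≤ p) :
    ∃ c D : ℝ, 0 < c ∧ 0 < D ∧ ∀ n : ℕ, 2 ≤ n →
      c * Real.exp (-D * Real.log n ^ p) ≤ logRate t n := by
  obtain ⟨D, hD, hlog⟩ := log_rpow_le_mul_log_rpow hp
  have h2 : 0 < Real.log 2 := Real.log_pos (by norm_num)
  refine ⟨Real.log 2 ^ t, D, by positivity, hD, fun n hn => ?_⟩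
  have hn1 : (1 : ℝ) ≤ n := by exact_mod_cast (by omega : 1 ≤ n)
  have hn0 : (0 : ℝ) < n := by linarith
  have h1 := hlog n hn
  rw [Real.rpow_one] at h1
  have h3 : Real.exp (-D * Real.log n ^ p) ≤ 1 / √n := by
    calc Real.exp (-D * Real.log n ^ p) ≤ Real.exp (-Real.log n) :=
          Real.exp_le_exp.2 (by linarith)
      _ = 1 / n := by rw [Real.exp_neg, Real.exp_log hn0, one_div]
      _ ≤ 1 / √n := by
          gcongr
          rw [Real.sqrt_le_left hn0.le]
          nlinarith
  rw [logRate, mul_comm]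
  gcongr
  exact_mod_cast hn

lemma exists_assumptionB {k : ℕ} [NeZero k] {G : ℕ+ → ℝ} (hP : AssumptionP G) {t₀ t : ℝ}
    (ht₀ : 1 ≤ 2 * t₀) (ht : 4 * t₀ < t) {C : ℝ} (hC : 0 < C) :
    ∃ C' : ℝ, AssumptionB (emissionPrior k G) (logRate t₀) (logRate t) C C' := by
  obtain ⟨g, D, Z, hg, hD, hZ, hDP⟩ := exists_dirichletProcess_sparseDensities hP
  obtain ⟨c, Dl, hc, hDl, hrate⟩ := exists_mul_exp_le_logRate (t := t) (by linarith) ht₀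
  obtain ⟨Dt, hDt, hlogt⟩ := log_rpow_le_mul_log_rpow (p := 2 * t₀ * 2) (r := 2 * t) (by linarith)
  have hk : (0 : ℝ) < k := by exact_mod_cast Nat.pos_of_ne_zero (NeZero.ne k)
  have hlog2 : 0 < Real.log 2 := Real.log_pos (by norm_num)
  set x : ℕ → ℝ := fun n => Real.log n ^ (2 * t₀) with hx
  set x₀ : ℝ := Real.log 2 ^ (2 * t₀) with hx₀
  have hx₀0 : 0 < x₀ := by positivity
  have hxx₀ : ∀ n : ℕ, 2 ≤ n → x₀ ≤ x n := fun n hn =>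
    Real.rpow_le_rpow hlog2.le (log_two_le_log_natCast hn) (by linarith)
  have hxlim : Tendsto x atTop atTop := tendsto_log_rpow_atTop (by linarith)
  -- All error terms are tuned to exp(-(C + 1) x); the spare e^{-x} later turns O into o. With y =
  -- exp(-D₁ x) one gets y^g = exp(-(C + 1) x). In D₂ the summands pay for y, for τ, and for the
  -- constants in Z e^{-t} ≤ τ y. In D₃ the 4 undoes the power -1/4 of L, and C + 2 leaves room for
  -- a factor x ≤ e^x.
  set D₁ := (C + 1) / g with hD₁
  set D₂ := D₁ + Dl + 1 with hD₂
  have hD₁0 : 0 < D₁ := by positivity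
  have hD₂0 : 0 < D₂ := by positivity
  set D₃ := 4 * (C + 2) with hD₃
  -- The admissible error ε_n/12 is split evenly: 2τ = ε_n/24, and M is chosen below so that R/M <
  -- ε_n/24.
  set τ : ℕ → ℝ := fun n => logRate t n / 48 with hτ
  set L : ℕ → ℕ+ := fun n => Nat.succPNat ⌊Real.exp (D₃ * x n)⌋₊ with hL
  set R : ℕ → ℕ := fun n => ⌈D * (D₂ * x n) + (C + 1) * x n⌉₊ with hR
  have hLle : ∀ n, Real.exp (D₃ * x n) ≤ (L n : ℝ) := fun n => by
    have := (Nat.lt_floor_add_one (Real.exp (D₃ * x n))).le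
    simpa [hL] using this
  have hLge : ∀ n, (L n : ℝ) ≤ Real.exp (D₃ * x n) + 1 := fun n => by
    have := Nat.floor_le (Real.exp_pos (D₃ * x n)).le
    simpa [hL] using this
  -- Additive constants are absorbed here and in B using x ≥ x₀ > 0, so that the bounds hold from n
  -- = 2 on.
  set E := D * D₂ + (C + 1) + 1 / x₀ with hE
  have hE0 : 0 < E := by positivity
  set a := 2 * (24 * E / c + 2) with ha
  have ha0 : 0 < a := by positivity
  set B := D₃ + Dl + 1 + a / x₀ with hB
  have hB0 : 0 < B := by positivity
  refine ⟨E * k * B * Dt, hC, by positivity,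
    fun n => {f | ∀ j, f j ∈ sparseDensities (R n) (L n) (τ n)}, fun n => ?_, ?_, 1, one_pos,
    fun n hn => ?_⟩
  · change MeasurableSet {f : Fin k → Density | ∀ j, f j ∈ sparseDensities (R n) (L n) (τ n)}
    have : {f : Fin k → Density | ∀ j, f j ∈ sparseDensities (R n) (L n) (τ n)} =
        ⋂ j, Function.eval j ⁻¹' sparseDensities (R n) (L n) (τ n) := by
      ext f; simp
    rw [this]
    exact MeasurableSet.iInter fun j =>
      (measurable_pi_apply j) (measurableSet_sparseDensities _ _ _)
  · have hbound : ∀ᶠ n : ℕ in atTop,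
        (emissionPrior k G).real {f | ∀ j, f j ∈ sparseDensities (R n) (L n) (τ n)}ᶜ ≤
          (k * (D + D * D₂ + 1)) * Real.exp (-(C + 1) * x n) := by
      have hsmall : ∀ᶠ n : ℕ in atTop, Real.exp (-x n) < c / (48 * Z) :=
        (Real.tendsto_exp_neg_atTop_nhds_zero.comp hxlim).eventually
          (gt_mem_nhds (by positivity))
      filter_upwards [eventually_ge_atTop 2, hsmall, hxlim.eventually_ge_atTop (1 / D₂)]
        with n hn hs h1
      have hxn : 0 < x n := hx₀0.trans_le (hxx₀ n hn)
      rw [div_le_iff₀' hD₂0] at h1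
      have hcond : Z * Real.exp (-(D₂ * x n)) ≤ τ n * Real.exp (-D₁ * x n) := by
        have e1 : Real.exp (-(D₂ * x n)) =
            Real.exp (-x n) * (Real.exp (-Dl * x n) * Real.exp (-D₁ * x n)) := by
          rw [← Real.exp_add, ← Real.exp_add]; congr 1; rw [hD₂]; ring
        have h2 : Z * Real.exp (-x n) ≤ c / 48 := by
          rw [lt_div_iff₀ (by positivity)] at hs
          linarith
        have h3 := hrate n hn
        calc Z * Real.exp (-(D₂ * x n))
            = Z * Real.exp (-x n) * Real.exp (-Dl * x n) * Real.exp (-D₁ * x n) := by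
              rw [e1]; ring
          _ ≤ c / 48 * Real.exp (-Dl * x n) * Real.exp (-D₁ * x n) := by gcongr
          _ = (c * Real.exp (-Dl * x n)) / 48 * Real.exp (-D₁ * x n) := by ring
          _ ≤ τ n * Real.exp (-D₁ * x n) := by
              simp only [hτ]
              gcongr
      have h4 := hDP (D₂ * x n) (Real.exp (-D₁ * x n)) (τ n) (R n) (L n) h1 (Real.exp_pos _) hcond
      have hLn : (0 : ℝ) < L n := by exact_mod_cast (L n).pos
      refine (emissionPrior_compl_le (measurableSet_sparseDensities _ _ _)
        (by positivity) h4).trans ?_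
      refine (mul_le_mul_of_nonneg_left ?_ hk.le).trans (le_of_eq (mul_assoc _ _ _).symm)
      have e2 : Real.exp (-D₁ * x n) ^ g = Real.exp (-(C + 1) * x n) := by
        rw [← Real.exp_mul]
        congr 1
        rw [hD₁]
        field_simp
      have e3 : x n * (L n : ℝ) ^ (-(1 / 4) : ℝ) ≤ Real.exp (-(C + 1) * x n) := by
        calc x n * (L n : ℝ) ^ (-(1 / 4) : ℝ)
            ≤ Real.exp (x n) * Real.exp (D₃ * x n) ^ (-(1 / 4) : ℝ) := by
              gcongr ?_ * ?_
              · linarith [Real.add_one_le_exp (x n)]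
              · exact Real.rpow_le_rpow_of_nonpos (Real.exp_pos _) (hLle n) (by norm_num)
          _ = Real.exp (-(C + 1) * x n) := by
              rw [← Real.exp_mul, ← Real.exp_add]
              congr 1
              rw [hD₃]
              ring
      have e4 : Real.exp (D * (D₂ * x n) - R n) ≤ Real.exp (-(C + 1) * x n) := by
        apply Real.exp_le_exp.2
        have := Nat.le_ceil (D * (D₂ * x n) + (C + 1) * x n)
        simp only [hR]
        linarith
      calc D * Real.exp (-D₁ * x n) ^ g + D * (D₂ * x n) * (L n : ℝ) ^ (-(1 / 4) : ℝ) +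
            Real.exp (D * (D₂ * x n) - R n)
          = D * Real.exp (-(C + 1) * x n) + D * D₂ * (x n * (L n : ℝ) ^ (-(1 / 4) : ℝ)) +
            Real.exp (D * (D₂ * x n) - R n) := by rw [e2]; ring
        _ ≤ D * Real.exp (-(C + 1) * x n) + D * D₂ * Real.exp (-(C + 1) * x n) +
            Real.exp (-(C + 1) * x n) := by gcongr
        _ = _ := by ring
    have hO : (fun n : ℕ =>
        (emissionPrior k G).real {f | ∀ j, f j ∈ sparseDensities (R n) (L n) (τ n)}ᶜ) =O[atTop]
          fun n => Real.exp (-(C + 1) * x n) := by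
      refine Asymptotics.IsBigO.of_bound (k * (D + D * D₂ + 1)) ?_
      filter_upwards [hbound] with n hn
      rwa [Real.norm_of_nonneg measureReal_nonneg, Real.norm_of_nonneg (Real.exp_pos _).le]
    have ho : (fun n : ℕ => Real.exp (-(C + 1) * x n)) =o[atTop]
        fun n : ℕ => Real.exp (-C * n * logRate t₀ n ^ 2) := by
      rw [Asymptotics.isLittleO_iff_tendsto' (Eventually.of_forall fun n h =>
        absurd h (Real.exp_pos _).ne')]
      refine (Real.tendsto_exp_neg_atTop_nhds_zero.comp hxlim).congr' ?_
      filter_upwards [eventually_ge_atTop 2] with n hn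
      rw [mul_assoc, mul_logRate_sq t₀ hn, ← Real.exp_sub]
      simp only [Function.comp, hx]
      congr 1
      ring
    exact hO.trans_isLittleO ho
  · have hxn0 := hxx₀ n hn
    have hxn : 0 < x n := hx₀0.trans_le hxn0
    have hε := logRate_pos t hn
    set M : ℕ := ⌊24 * R n / logRate t n⌋₊ + 1 with hM
    have hMgt : 24 * R n / logRate t n < M := by
      rw [hM]; push_cast; exact Nat.lt_floor_add_one _
    have hM0 : (0 : ℝ) < M := lt_of_le_of_lt (by positivity) hMgt
    have hcov := coveringNumber_sparseDensities_le (k := k) (R n) (L n) M (Nat.succ_pos _)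
      (τ := τ n) (ε := logRate t n / 12) (by
        rw [div_lt_iff₀ hε] at hMgt
        have : (R n : ℝ) / M < logRate t n / 24 := by
          rw [div_lt_div_iff₀ hM0 (by norm_num)]
          linarith
        simp only [hτ]
        linarith)
    have hcov' := (ENat.toENNReal_le.2 hcov)
    refine hcov'.trans ?_
    rw [ENat.toENNReal_coe, ← ENNReal.ofReal_natCast, one_mul]
    refine ENNReal.ofReal_le_ofReal ?_
    push_cast
    have hRle : (R n : ℝ) ≤ E * x n := by
      have h1 := (Nat.ceil_lt_add_one (a := D * (D₂ * x n) + (C + 1) * x n) (by positivity)).le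
      have h2 : 1 ≤ 1 / x₀ * x n := by
        rw [one_div, ← div_eq_inv_mul, one_le_div hx₀0]
        exact hxn0
      simp only [hR, hE]
      linarith
    have hMle : (M : ℝ) + 1 ≤ (24 * E / c + 2) * Real.exp ((Dl + 1) * x n) := by
      have h1 := Nat.floor_le (a := 24 * R n / logRate t n) (by positivity)
      have h2 : 24 * R n / logRate t n ≤ 24 * (E * Real.exp (x n)) / (c * Real.exp (-Dl * x n)) := by
        have h5 := Real.add_one_le_exp (x n)
        have h6 := hrate n hn
        gcongr
        exact hRle.trans (by gcongr; linarith)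
      have h3 : 24 * (E * Real.exp (x n)) / (c * Real.exp (-Dl * x n)) =
          24 * E / c * Real.exp ((Dl + 1) * x n) := by
        rw [neg_mul, Real.exp_neg, add_mul Dl, one_mul, Real.exp_add]
        field_simp
      have h4 : 1 ≤ Real.exp ((Dl + 1) * x n) := Real.one_le_exp (by positivity)
      rw [hM]
      push_cast
      linarith
    have hLM : (L n : ℝ) * (M + 1) ≤ Real.exp (B * x n) := by
      have h1 : (L n : ℝ) ≤ 2 * Real.exp (D₃ * x n) := by
        have := hLge n
        have h4 : 1 ≤ Real.exp (D₃ * x n) := Real.one_le_exp (by positivity)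
        linarith
      calc (L n : ℝ) * (M + 1)
          ≤ 2 * Real.exp (D₃ * x n) * ((24 * E / c + 2) * Real.exp ((Dl + 1) * x n)) := by gcongr
        _ = a * Real.exp ((D₃ + Dl + 1) * x n) := by
            have : (D₃ + Dl + 1) * x n = D₃ * x n + (Dl + 1) * x n := by ring
            rw [this, Real.exp_add]
            ring
        _ ≤ Real.exp (a / x₀ * x n) * Real.exp ((D₃ + Dl + 1) * x n) := by
            gcongr
            exact le_exp_div_mul ha0.le hx₀0 hxn0
        _ = Real.exp (B * x n) := by
            rw [← Real.exp_add]
            congr 1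
            rw [hB]
            ring
    -- The entropy is the number of atoms, O(x), times the logarithm of the choices per atom, again
    -- O(x); this square is why ε_n carries a larger power of log n than ε̃_n.
    have hsq : x n * x n ≤ Dt * Real.log n ^ (2 * t) := by
      have h1 := hlogt n hn
      rw [Real.rpow_mul (log_natCast_pos hn).le, Real.rpow_two] at h1
      simp only [hx]
      linarith
    calc ((L n : ℝ) * (M + 1)) ^ (R n * k) ≤ Real.exp (B * x n) ^ (R n * k) := by gcongr
      _ = Real.exp (R n * k * (B * x n)) := by rw [← Real.exp_nat_mul]; push_cast; rfl
      _ ≤ Real.exp (E * k * B * Dt * n * logRate t n ^ 2) := by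
          apply Real.exp_le_exp.2
          rw [mul_assoc _ (n : ℝ), mul_logRate_sq t hn]
          calc R n * k * (B * x n) ≤ E * x n * k * (B * x n) := by gcongr
            _ = E * k * B * (x n * x n) := by ring
            _ ≤ E * k * B * (Dt * Real.log n ^ (2 * t)) := by gcongr
            _ = _ := by ring

/-! ### Neighbourhoods of the true emission densities -/

lemma logSqRatio_of_pos {x y : ℝ} (hx : 0 < x) (hy : 0 < y) :
    logSqRatio x y = ENNReal.ofReal (Real.log (x / y) ^ 2) := by
  unfold logSqRatio
  rw [if_neg (by rintro (h | h) <;> linarith)]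

lemma tsum_ofReal_subtype_le {S : Set ℕ+} {u : S → ℝ≥0∞} {v : ℕ+ → ℝ} (hv0 : ∀ l, 0 ≤ v l)
    (hv : Summable v) (huv : ∀ l : S, u l ≤ ENNReal.ofReal (v l)) :
    ∑' l : S, u l ≤ ENNReal.ofReal (∑' l, v l) := by
  rw [ENNReal.ofReal_tsum_of_nonneg hv0 hv]
  exact (ENNReal.tsum_le_tsum huv).trans
    (ENNReal.tsum_comp_le_tsum_of_injective Subtype.val_injective _)

/-- Writing y = x e^{-log(x/y)}, the bound |e^z - 1| ≤ 2|z| gives x (2ρ)², and ρ ≤ 1 makes it linear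
in ρ. -/
lemma abs_sub_sq_div_le {x y ρ : ℝ} (hx : 0 < x) (hy : 0 < y) (hρ1 : ρ ≤ 1)
    (h : |Real.log (x / y)| ≤ ρ) : |x - y| ^ 2 / x ≤ 4 * ρ * x := by
  have hρ0 : 0 ≤ ρ := (abs_nonneg _).trans h
  have e : y = x * Real.exp (-Real.log (x / y)) := by
    rw [Real.exp_neg, Real.exp_log (by positivity)]
    field_simp
  have h1 : |Real.exp (-Real.log (x / y)) - 1| ≤ 2 * ρ := by
    refine (Real.abs_exp_sub_one_le (by rw [abs_neg]; exact h.trans hρ1)).trans ?_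
    rw [abs_neg]
    linarith
  have h2 : |x - y| = x * |Real.exp (-Real.log (x / y)) - 1| := by
    rw [abs_sub_comm, ← abs_of_pos hx, ← abs_mul, abs_of_pos hx, mul_sub, mul_one, ← e]
  rw [h2]
  calc (x * |Real.exp (-Real.log (x / y)) - 1|) ^ 2 / x
      = x * |Real.exp (-Real.log (x / y)) - 1| ^ 2 := by field_simp
    _ ≤ x * (2 * ρ) ^ 2 := by gcongr
    _ ≤ 4 * ρ * x := by nlinarith [mul_nonneg hx.le hρ0]

/-- One small number ρ controls everything: it bounds log-ratios on the head, and the sum of h,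
which dominates both f* and f* W² on the tail. The factor 4 covers ρ² + ρ from the squared
logarithms and 4ρ from the χ² term. -/
lemma klConditions_of_close {k : ℕ} [NeZero k] {f' f : Fin k → Density} {N : ℕ+} {ρ e u : ℝ}
    {W h : ℕ+ → ℝ} (hpos' : ∀ j l, 0 < f' j l) (hpos : ∀ j l, 0 < f j l) (hρ1 : ρ ≤ 1)
    (hhead : ∀ j l, l ≤ N → |Real.log (f' j l / f j l)| ≤ ρ)
    (htail : ∀ j l, N < l → |Real.log (f' j l / f j l)| ≤ W l)
    (hh0 : ∀ l, 0 ≤ h l) (hsum : Summable h) (hhρ : ∑' l, h l ≤ ρ)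
    (hW : ∀ i l, N < l → f' i l * W l ^ 2 ≤ h l) (hf'h : ∀ i l, N < l → f' i l ≤ h l)
    (he : 4 * ρ ≤ e ^ 2) (heu : 4 * ρ ≤ e ^ 2 / u) : KLConditions f' f e u := by
  have hρ0 : 0 ≤ ρ := (tsum_nonneg hh0).trans hhρ
  have htl : ∀ j, ∑' l : ((Set.Iic N)ᶜ : Set ℕ+), ENNReal.ofReal (f' j l) ≤
      ENNReal.ofReal ρ := fun j =>
    (tsum_ofReal_subtype_le hh0 hsum fun l => ENNReal.ofReal_le_ofReal
      (hf'h j l (not_le.1 l.2))).trans (ENNReal.ofReal_le_ofReal hhρ)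
  -- With f̃ = f* the mass of f̃ off S is the tail of f*, and the final χ² condition is 0.
  refine ⟨fun i j => ?_, Set.Iic N, f', fun j => ?_, fun j => ?_, fun j => ?_, fun j l _ =>
    ⟨hpos' j l, hpos j l⟩, fun i => ⟨?_, ?_⟩, fun j => ?_⟩
  · have hs : HasSum (fun l => ρ ^ 2 * f' i l + h l) (ρ ^ 2 * 1 + ∑' l, h l) :=
      ((f' i).2.2.mul_left _).add hsum.hasSum
    calc ∑' l, ENNReal.ofReal (f' i l) * logSqRatio (f' j l) (f j l)
        ≤ ∑' l, ENNReal.ofReal (ρ ^ 2 * f' i l + h l) := by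
          refine ENNReal.tsum_le_tsum fun l => ?_
          rw [logSqRatio_of_pos (hpos' j l) (hpos j l), ← ENNReal.ofReal_mul (hpos' i l).le]
          refine ENNReal.ofReal_le_ofReal ?_
          have h0 := (hpos' i l).le
          by_cases hl : l ≤ N
          · have h1 : Real.log (f' j l / f j l) ^ 2 ≤ ρ ^ 2 :=
              sq_le_sq' (abs_le.1 (hhead j l hl)).1 (abs_le.1 (hhead j l hl)).2
            nlinarith [hh0 l]
          · rw [not_le] at hl
            have h1 : Real.log (f' j l / f j l) ^ 2 ≤ W l ^ 2 :=
              sq_le_sq' (abs_le.1 (htail j l hl)).1 (abs_le.1 (htail j l hl)).2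
            have h2 := hW i l hl
            have h3 : f' i l * Real.log (f' j l / f j l) ^ 2 ≤ f' i l * W l ^ 2 := by gcongr
            have h4 : 0 ≤ ρ ^ 2 * f' i l := by positivity
            linarith
      _ = ENNReal.ofReal (ρ ^ 2 * 1 + ∑' l, h l) := by
          rw [← ENNReal.ofReal_tsum_of_nonneg (fun l => add_nonneg
            (mul_nonneg (sq_nonneg _) (hpos' i l).le) (hh0 l)) hs.summable, hs.tsum_eq]
      _ ≤ ENNReal.ofReal (e ^ 2 / u) := ENNReal.ofReal_le_ofReal (by nlinarith)
  · have hs := (f' j).2.2.mul_left (4 * ρ)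
    refine (tsum_ofReal_subtype_le (v := fun l => 4 * ρ * f' j l)
      (fun l => mul_nonneg (by positivity) (hpos' j l).le) hs.summable fun l => ?_).trans
      (ENNReal.ofReal_le_ofReal (by rw [hs.tsum_eq]; linarith))
    rw [← ENNReal.ofReal_div_of_pos (hpos' j l)]
    exact ENNReal.ofReal_le_ofReal
      (abs_sub_sq_div_le (hpos' j l) (hpos j l) hρ1 (hhead j l l.2))
  · exact (htl j).trans (ENNReal.ofReal_le_ofReal (by linarith))
  · exact (htl j).trans (ENNReal.ofReal_le_ofReal (by linarith))
  · have : Finite (Set.Iic N) := (Set.finite_Iic N).to_subtype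
    exact Summable.of_finite
  · have : Finite (Set.Iic N) := (Set.finite_Iic N).to_subtype
    have hs := (f' i).2.2.mul_right ρ
    calc ∑' l : Set.Iic N, f' i l * ⨆ j, Real.log (f' j l / f j l)
        ≤ ∑' l : Set.Iic N, f' i l * ρ := by
          refine Summable.tsum_le_tsum (fun l => ?_) Summable.of_finite Summable.of_finite
          refine mul_le_mul_of_nonneg_left (ciSup_le fun j => ?_) (hpos' i l).le
          exact (le_abs_self _).trans (hhead j l l.2)
      _ ≤ ∑' l, f' i l * ρ :=
          hs.summable.tsum_subtype_le _ _ fun l => mul_nonneg (hpos' i l).le hρ0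
      _ ≤ e ^ 2 := by rw [hs.tsum_eq]; linarith
  · simp

/-- The densities that are close to `f` on `{1, …, N}` and not too small elsewhere. -/
def closeDensities (f : Density) (N : ℕ+) (ρ : ℝ) (V : ℕ+ → ℝ) : Set Density :=
  {h | ∀ l, 0 < h l ∧ (l ≤ N → |Real.log (f l / h l)| ≤ ρ) ∧ (N < l → Real.exp (-V l) ≤ h l)}

lemma measurableSet_closeDensities (f : Density) (N : ℕ+) (ρ : ℝ) (V : ℕ+ → ℝ) :
    MeasurableSet (closeDensities f N ρ V) := by
  have : closeDensities f N ρ V = ⋂ l, ({h : Density | 0 < h l} ∩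
      ({h : Density | l ≤ N → |Real.log (f l / h l)| ≤ ρ} ∩
        {h : Density | N < l → Real.exp (-V l) ≤ h l})) := by
    ext h; simp [closeDensities]
  rw [this]
  refine MeasurableSet.iInter fun l => ?_
  have hm := Density.measurable_apply l
  refine (measurableSet_lt measurable_const hm).inter (MeasurableSet.inter ?_ ?_)
  · by_cases hl : l ≤ N
    · simp only [hl, true_imp_iff]
      have h1 : Measurable fun h : Density => |Real.log (f l / h l)| :=
        _root_.measurable_abs.comp (Real.measurable_log.comp (measurable_const.div hm))
      exact measurableSet_le h1 measurable_const
    · simp [hl]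
  · by_cases hl : N < l
    · simp only [hl, true_imp_iff]
      exact measurableSet_le measurable_const hm
    · simp [hl]

/-- Normalising shifts all log-weights by log T, and T lies between 1 - τ, from the head alone, and
e^η + ηZ ≤ e^{η(1+Z)}; hence |log T| is small. -/
lemma normalise_mem_closeDensities {f : Density} {N : ℕ+} {η τ ρ : ℝ} {lo V γ : ℕ+ → ℝ}
    (hf : ∀ l, 0 < f l) (hη0 : 0 ≤ η) (hη1 : η ≤ 1) (hτ : τ ≤ 1 / 2)
    (hfτ : 1 - τ ≤ ∑ l ∈ Finset.Icc 1 N, f l)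
    (hhead : ∀ l, l ≤ N → f l ≤ γ l ∧ γ l ≤ f l * Real.exp η) (hlo : ∀ l, 0 < lo l)
    (htail : ∀ l, N < l → lo l ≤ γ l ∧ γ l ≤ η * (l : ℝ) ^ (-2 : ℝ))
    (hρ : η * (1 + ∑' l : ℕ+, (l : ℝ) ^ (-2 : ℝ)) + 2 * τ ≤ ρ)
    (hV : ∀ l, N < l → 1 + (∑' l : ℕ+, (l : ℝ) ^ (-2 : ℝ)) - Real.log (lo l) ≤ V l) :
    normalise γ ∈ closeDensities f N ρ V := by
  set Z := ∑' l : ℕ+, (l : ℝ) ^ (-2 : ℝ) with hZ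
  have hZ0 : 0 ≤ Z := tsum_nonneg fun l => by positivity
  have hγ : ∀ l, 0 < γ l := by
    intro l
    by_cases hl : l ≤ N
    · exact (hf l).trans_le (hhead l hl).1
    · exact (hlo l).trans_le (htail l (not_le.1 hl)).1
  have hb : HasSum (fun l : ℕ+ => f l * Real.exp η + η * (l : ℝ) ^ (-2 : ℝ))
      (1 * Real.exp η + η * Z) :=
    (f.2.2.mul_right _).add ((summable_pnat_rpow (p := 2) (by norm_num)).hasSum.mul_left η)
  have hle : ∀ l, γ l ≤ f l * Real.exp η + η * (l : ℝ) ^ (-2 : ℝ) := by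
    intro l
    have h1 : 0 ≤ f l * Real.exp η := mul_nonneg (hf l).le (Real.exp_pos _).le
    have h2 : 0 ≤ η * (l : ℝ) ^ (-2 : ℝ) := by positivity
    by_cases hl : l ≤ N
    · linarith [(hhead l hl).2]
    · linarith [(htail l (not_le.1 hl)).2]
  have hs : Summable γ := Summable.of_nonneg_of_le (fun l => (hγ l).le) hle hb.summable
  set T := ∑' l, γ l with hT
  have hTle : T ≤ Real.exp (η * (1 + Z)) := by
    have h1 : T ≤ 1 * Real.exp η + η * Z :=
      (hs.tsum_le_tsum hle hb.summable).trans (le_of_eq hb.tsum_eq)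
    have h2 : 1 ≤ Real.exp η := Real.one_le_exp hη0
    have h3 : η * Z ≤ Real.exp η * (η * Z) := le_mul_of_one_le_left (by positivity) h2
    have h4 := Real.add_one_le_exp (η * Z)
    calc T ≤ Real.exp η * (η * Z + 1) := by linarith
      _ ≤ Real.exp η * Real.exp (η * Z) := by gcongr
      _ = Real.exp (η * (1 + Z)) := by rw [← Real.exp_add]; congr 1; ring
  have hTge : 1 - τ ≤ T := by
    refine hfτ.trans ((Finset.sum_le_sum fun l hl => (hhead l (Finset.mem_Icc.1 hl).2).1).trans ?_)
    exact hs.sum_le_tsum _ fun l _ => (hγ l).le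
  have hT0 : 0 < T := by linarith
  have hlogle : Real.log T ≤ η * (1 + Z) := by
    rw [← Real.log_exp (η * (1 + Z))]
    exact Real.log_le_log hT0 hTle
  have hτ0 : 0 ≤ τ := by
    have h1 : ∑ l ∈ Finset.Icc 1 N, f l ≤ 1 := sum_le_hasSum _ (fun l _ => (hf l).le) f.2.2
    linarith
  have hlogge : -(2 * τ) ≤ Real.log T := by
    have h1 := Real.one_sub_inv_le_log_of_pos (x := 1 - τ) (by linarith)
    have h2 : Real.log (1 - τ) ≤ Real.log T := Real.log_le_log (by linarith) hTge
    have h3 : (1 - τ)⁻¹ ≤ 1 + 2 * τ := by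
      rw [inv_le_iff_one_le_mul₀ (by linarith)]
      nlinarith
    linarith
  intro l
  rw [normalise_apply (fun l => (hγ l).le) hT0]
  refine ⟨div_pos (hγ l) hT0, fun hl => ?_, fun hl => ?_⟩
  · rw [Real.log_div (hf l).ne' (div_pos (hγ l) hT0).ne', Real.log_div (hγ l).ne' hT0.ne']
    have h1 := Real.log_le_log (hf l) (hhead l hl).1
    have h2 := Real.log_le_log (hγ l) (hhead l hl).2
    rw [Real.log_mul (hf l).ne' (Real.exp_pos _).ne', Real.log_exp] at h2
    have h3 : 0 ≤ η * Z := by positivity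
    rw [abs_le]
    constructor <;> linarith
  · rw [← Real.le_log_iff_exp_le (div_pos (hγ l) hT0), Real.log_div (hγ l).ne' hT0.ne']
    have h1 := Real.log_le_log (hlo l) (htail l hl).1
    have h2 := hV l hl
    have h3 : η * (1 + Z) ≤ 1 + Z := mul_le_of_le_one_left (by positivity) hη1
    linarith

/-! ### Prior mass of the neighbourhoods -/

/-- The rectangle of unnormalised weights that are close to `f` on `{1, …, N}` and small, but not
too small, elsewhere. -/
def gammaBox (f : Density) (N : ℕ+) (η β : ℝ) (l : ℕ+) : Set ℝ :=
  if l ≤ N then Set.Icc (f l) (f l * Real.exp η)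
  else Set.Icc (η * (l : ℝ) ^ (-2 : ℝ) * Real.exp (-(l : ℝ) ^ β)) (η * (l : ℝ) ^ (-2 : ℝ))

lemma measurableSet_gammaBox (f : Density) (N : ℕ+) (η β : ℝ) (l : ℕ+) :
    MeasurableSet (gammaBox f N η β l) := by
  unfold gammaBox
  split_ifs <;> exact measurableSet_Icc

/-- This writes a factor near 1 as the exponential of a small cost, ready to be summed over
coordinates. It follows from log(1 - y) ≥ -y/(1 - y). -/
lemma exp_neg_mul_exp_neg_le {a x : ℝ} (ha : 0 < a) (hx : a ≤ x) :
    Real.exp (-(1 / (1 - Real.exp (-a)) * Real.exp (-x))) ≤ 1 - Real.exp (-x) := by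
  have h1 : Real.exp (-a) < 1 := Real.exp_lt_one_iff.2 (by linarith)
  have h2 : Real.exp (-x) ≤ Real.exp (-a) := Real.exp_le_exp.2 (by linarith)
  have hy := Real.exp_pos (-x)
  set y := Real.exp (-x)
  have hy1 : 0 < 1 - y := by linarith
  rw [← Real.le_log_iff_exp_le hy1]
  refine le_trans ?_ (Real.one_sub_inv_le_log_of_pos hy1)
  have h3 : 1 - (1 - y)⁻¹ = -(1 / (1 - y) * y) := by field_simp; ring
  rw [h3]
  have h4 : 1 / (1 - y) ≤ 1 / (1 - Real.exp (-a)) :=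
    one_div_le_one_div_of_le (by linarith) (by linarith)
  have h5 : 1 / (1 - y) * y ≤ 1 / (1 - Real.exp (-a)) * y := by gcongr
  linarith

/-- By e^z ≥ 1 + z, (φ e^η)^g - φ^g ≥ φ^g η g. Only -log η and -log g lack a small factor, and they
are paid on the head alone. -/
lemma exp_neg_le_gammaLaw_head {g φ η M : ℝ} (hg : 0 < g) (hφ : 0 < φ) (hη : 0 < η)
    (hM : Real.Gamma (g + 1) ≤ Real.exp (M * g)) :
    ENNReal.ofReal (Real.exp (-(φ * Real.exp η + M * g + g * -Real.log φ + -Real.log η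
      + -Real.log g))) ≤ gammaLaw g (Set.Icc φ (φ * Real.exp η)) := by
  have hΓ : 0 < Real.Gamma (g + 1) := Real.Gamma_pos_of_pos (by linarith)
  refine le_trans (ENNReal.ofReal_le_ofReal ?_) (le_gammaLaw_Icc hg hφ
    (le_mul_of_one_le_right hφ.le (Real.one_le_exp hη.le)))
  have h1 : φ ^ g * (η * g) ≤ (φ * Real.exp η) ^ g - φ ^ g := by
    rw [Real.mul_rpow hφ.le (Real.exp_pos _).le, ← Real.exp_mul]
    have := Real.add_one_le_exp (η * g)
    have h2 : 0 < φ ^ g := by positivity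
    nlinarith
  have e : Real.exp (-(φ * Real.exp η + M * g + g * -Real.log φ + -Real.log η + -Real.log g)) =
      Real.exp (-(φ * Real.exp η)) * (φ ^ g * (η * g)) / Real.exp (M * g) := by
    have e' : η * g = Real.exp (Real.log η) * Real.exp (Real.log g) := by
      rw [Real.exp_log hη, Real.exp_log hg]
    rw [Real.rpow_def_of_pos hφ, e', ← Real.exp_add, ← Real.exp_add, ← Real.exp_add,
      ← Real.exp_sub]
    congr 1
    ring
  have h2 : 0 ≤ (φ * Real.exp η) ^ g - φ ^ g := le_trans (by positivity) h1
  rw [e]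
  gcongr

/-- The endpoints have ratio e^{-x}, so the increment of the g-th power is up^g (1 - e^{-gx}). Once
gx is bounded below, the last factor costs O(e^{-gx}), with no -log g. -/
lemma exp_neg_le_gammaLaw_tail {g a up x M : ℝ} (hg : 0 < g) (ha : 0 < a) (hup : 0 < up)
    (hM : Real.Gamma (g + 1) ≤ Real.exp (M * g)) (hx : 0 ≤ x) (hax : a ≤ g * x) :
    ENNReal.ofReal (Real.exp (-(up + M * g + g * -Real.log up +
      1 / (1 - Real.exp (-a)) * Real.exp (-(g * x))))) ≤
      gammaLaw g (Set.Icc (up * Real.exp (-x)) up) := by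
  have hΓ : 0 < Real.Gamma (g + 1) := Real.Gamma_pos_of_pos (by linarith)
  refine le_trans (ENNReal.ofReal_le_ofReal ?_) (le_gammaLaw_Icc hg
    (mul_pos hup (Real.exp_pos _)) (mul_le_of_le_one_right hup.le (Real.exp_le_one_iff.2
      (by linarith))))
  have h1 : up ^ g - (up * Real.exp (-x)) ^ g = up ^ g * (1 - Real.exp (-(g * x))) := by
    rw [Real.mul_rpow hup.le (Real.exp_pos _).le, ← Real.exp_mul]
    have : -x * g = -(g * x) := by ring
    rw [this]
    ring
  have h2 := exp_neg_mul_exp_neg_le ha hax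
  have e : Real.exp (-(up + M * g + g * -Real.log up +
      1 / (1 - Real.exp (-a)) * Real.exp (-(g * x)))) = Real.exp (-up) * (up ^ g *
        Real.exp (-(1 / (1 - Real.exp (-a)) * Real.exp (-(g * x))))) / Real.exp (M * g) := by
    rw [Real.rpow_def_of_pos hup, ← Real.exp_add, ← Real.exp_add, ← Real.exp_sub]
    congr 1
    ring
  rw [e, h1]
  have h3 : 0 < up ^ g := by positivity
  have h4 : 0 ≤ 1 - Real.exp (-(g * x)) := (Real.exp_pos _).le.trans h2
  gcongr

lemma log_le_two_mul_rpow_half (l : ℕ+) : Real.log l ≤ 2 * (l : ℝ) ^ (1 / 2 : ℝ) := by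
  have h := Real.log_le_rpow_div (x := (l : ℝ)) (ε := 1 / 2) (by positivity) (by norm_num)
  linarith

lemma summable_pnat_exp_neg_mul {a : ℝ} (ha : 0 < a) :
    Summable fun l : ℕ+ => Real.exp (-(a * (l : ℝ))) := by
  have h := summable_pnat_rpow_mul_exp (p := 0) le_rfl ha one_pos
  simpa using h

/-- The exponent α + 1 in the box gives G(l) l^{α+1} ≥ a l, so the tail intervals are long enough
for their losses e^{-a l} to be summable. On the head, G(l) ≤ A/l brings in the sum controlled by
`hsum`, hence N^K; the price c N^m of the relative width η, paid N times, gives N^{m+1}. -/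
lemma exists_le_infinitePi_gammaBox {G : ℕ+ → ℝ} {a A α : ℝ} (ha : 0 < a) (hA : 0 < A)
    (hα : 2 ≤ α) (hG : ∀ l : ℕ+, a * (l : ℝ) ^ (-α) ≤ G l ∧ G l ≤ A * (l : ℝ) ^ (-α))
    {m c B K : ℝ} (hm : 0 < m) (hc : 0 < c) (hB : 0 < B) :
    ∃ D : ℝ, 0 < D ∧ ∀ (f : Density) (N : ℕ+), (∀ l, 0 < f l) →
      ∑ l ∈ Finset.Icc 1 N, -Real.log (f l) / (l : ℝ) ≤ B * (N : ℝ) ^ K →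
      ENNReal.ofReal (Real.exp (-(D * ((N : ℝ) ^ (m + 1) + (N : ℝ) ^ K)))) ≤
        Measure.infinitePi (fun l => gammaLaw (G l))
          (Set.univ.pi (gammaBox f N (Real.exp (-(c * (N : ℝ) ^ m))) (α + 1))) := by
  have hGpos : ∀ l, 0 < G l := fun l => by
    have hl : (0 : ℝ) < l := by exact_mod_cast l.pos
    exact lt_of_lt_of_le (by positivity) (hG l).1
  have hG2 : ∀ l : ℕ+, G l ≤ A * (l : ℝ) ^ (-2 : ℝ) := fun l => by
    refine (hG l).2.trans ?_
    gcongr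
    · exact one_le_pnat l
  have hGA : ∀ l : ℕ+, G l ≤ A := fun l => by
    refine (hG2 l).trans (mul_le_of_le_one_right hA.le ?_)
    exact Real.rpow_le_one_of_one_le_of_nonpos (one_le_pnat l) (by norm_num)
  obtain ⟨M, hM0, hM⟩ := Gamma_one_add_le_exp hA
  have hs2 := summable_pnat_rpow (p := 2) (by norm_num)
  have hs32 := summable_pnat_rpow (p := 3 / 2) (by norm_num)
  have hse := summable_pnat_exp_neg_mul ha
  set Z := ∑' l : ℕ+, (l : ℝ) ^ (-2 : ℝ) with hZ
  set Z₁ := ∑' l : ℕ+, (l : ℝ) ^ (-(3 / 2) : ℝ) with hZ₁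
  set Z₂ := ∑' l : ℕ+, Real.exp (-(a * (l : ℝ))) with hZ₂
  have hZ0 : 0 ≤ Z := tsum_nonneg fun l => by positivity
  have hZ₁0 : 0 ≤ Z₁ := tsum_nonneg fun l => by positivity
  have hZ₂0 : 0 ≤ Z₂ := tsum_nonneg fun l => by positivity
  set b₀ := 1 / (1 - Real.exp (-a)) with hb₀
  have hb₀0 : 0 < b₀ := by
    have : Real.exp (-a) < 1 := Real.exp_lt_one_iff.2 (by linarith)
    rw [hb₀]
    exact one_div_pos.2 (by linarith)
  set D₁ := 3 + (1 + M * A + A * c) * Z + 4 * A * Z₁ + b₀ * Z₂ + (c + α / m + |Real.log a|) with hD₁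
  have hD₁0 : 0 < D₁ := by positivity
  refine ⟨D₁ + A * B, by positivity, fun f N hf hsum => ?_⟩
  have hN1 := one_le_pnat N
  have hN0 : (0 : ℝ) < N := by linarith
  set η := Real.exp (-(c * (N : ℝ) ^ m)) with hη
  have hη0 : 0 < η := Real.exp_pos _
  have hη1 : η ≤ 1 := Real.exp_le_one_iff.2 (by
    have : 0 ≤ c * (N : ℝ) ^ m := by positivity
    linarith)
  have hlogη : -Real.log η = c * (N : ℝ) ^ m := by rw [hη, Real.log_exp]; ring
  have hflog : ∀ l, 0 ≤ -Real.log (f l) := fun l => by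
    have := Real.log_nonpos (hf l).le (f.le_one l)
    linarith
  have hlogN : Real.log N ≤ (N : ℝ) ^ m / m := Real.log_le_rpow_div hN0.le hm
  have hlogN0 : 0 ≤ Real.log N := Real.log_nonneg hN1
  -- The cost is split into u, summable over all atoms with sum O(N^m), and v, paid only for l ≤ N.
  -- The 3 bounds e^η, as η ≤ 1.
  set u : ℕ+ → ℝ := fun l => 3 * f l + (1 + M * A + A * (c * (N : ℝ) ^ m)) * (l : ℝ) ^ (-2 : ℝ) +
    4 * A * (l : ℝ) ^ (-(3 / 2) : ℝ) + b₀ * Real.exp (-(a * (l : ℝ))) with hu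
  set v : ℕ+ → ℝ := fun l => A * (-Real.log (f l) / (l : ℝ)) +
    (c * (N : ℝ) ^ m + α * Real.log N + |Real.log a|) with hv
  have hu0 : ∀ l, 0 ≤ u l := fun l => by
    have := (hf l).le
    simp only [hu]
    positivity
  have hv0 : ∀ l, 0 ≤ v l := fun l => by
    have := hflog l
    simp only [hv]
    positivity
  have husum : HasSum u (3 * 1 + (1 + M * A + A * (c * (N : ℝ) ^ m)) * Z + 4 * A * Z₁ +
      b₀ * Z₂) :=
    (((f.2.2.mul_left 3).add (hs2.hasSum.mul_left _)).add (hs32.hasSum.mul_left _)).add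
      (hse.hasSum.mul_left _)
  refine le_infinitePi_pi _ (measurableSet_gammaBox f N η (α + 1))
    (fun l => u l + if l ∈ Finset.Icc 1 N then v l else 0) _ (fun l => ?_) (fun s => ?_)
  · have hl0 : (0 : ℝ) < l := by exact_mod_cast l.pos
    have hl1 := one_le_pnat l
    have hMl := hM (G l) (hGpos l) (hGA l)
    have hMG : M * G l ≤ M * A * (l : ℝ) ^ (-2 : ℝ) := by
      rw [mul_assoc]
      exact mul_le_mul_of_nonneg_left (hG2 l) hM0
    have hl2 : 0 < (l : ℝ) ^ (-2 : ℝ) := by positivity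
    have hl32 : 0 < (l : ℝ) ^ (-(3 / 2) : ℝ) := by positivity
    by_cases hl : l ≤ N
    · have hlN : (l : ℝ) ≤ N := by exact_mod_cast hl
      rw [gammaBox, if_pos hl]
      refine le_trans (ENNReal.ofReal_le_ofReal (Real.exp_le_exp.2 (neg_le_neg ?_)))
        (exp_neg_le_gammaLaw_head (hGpos l) (hf l) hη0 hMl)
      rw [if_pos (Finset.mem_Icc.2 ⟨one_le, hl⟩), hlogη]
      have h1 : f l * Real.exp η ≤ 3 * f l := by
        have h2 : Real.exp η ≤ 3 :=
          (Real.exp_le_exp.2 hη1).trans (by linarith [Real.exp_one_lt_d9])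
        nlinarith [hf l]
      have h2 : G l * -Real.log (f l) ≤ A * (-Real.log (f l) / (l : ℝ)) := by
        have h3 : G l ≤ A / l := by
          refine (hG2 l).trans ?_
          rw [div_eq_mul_inv, ← Real.rpow_neg_one]
          exact mul_le_mul_of_nonneg_left
            (Real.rpow_le_rpow_of_exponent_le hl1 (by norm_num)) hA.le
        calc G l * -Real.log (f l) ≤ A / l * -Real.log (f l) :=
              mul_le_mul_of_nonneg_right h3 (hflog l)
          _ = _ := by ring
      have h3 : -Real.log (G l) ≤ α * Real.log N + |Real.log a| := by
        have h4 := Real.log_le_log (by positivity) (hG l).1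
        rw [Real.log_mul ha.ne' (by positivity), Real.log_rpow hl0] at h4
        have h5 : α * Real.log l ≤ α * Real.log N := by
          gcongr
        have h6 := neg_abs_le (Real.log a)
        linarith
      have h4 : 0 ≤ 4 * A * (l : ℝ) ^ (-(3 / 2) : ℝ) + b₀ * Real.exp (-(a * (l : ℝ))) := by
        positivity
      have h5 : 0 ≤ (1 + A * (c * (N : ℝ) ^ m)) * (l : ℝ) ^ (-2 : ℝ) := by positivity
      simp only [hu, hv]
      linarith
    · have hup : 0 < η * (l : ℝ) ^ (-2 : ℝ) := by positivity
      have hax : a * l ≤ G l * (l : ℝ) ^ (α + 1) := by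
        have h1 : a * (l : ℝ) = a * (l : ℝ) ^ (-α) * (l : ℝ) ^ (α + 1) := by
          rw [mul_assoc, ← Real.rpow_add hl0]
          simp
        rw [h1]
        exact mul_le_mul_of_nonneg_right (hG l).1 (by positivity)
      rw [gammaBox, if_neg hl]
      refine le_trans (ENNReal.ofReal_le_ofReal (Real.exp_le_exp.2 (neg_le_neg ?_)))
        (exp_neg_le_gammaLaw_tail (hGpos l) ha hup hMl (by positivity)
          ((le_mul_of_one_le_right ha.le hl1).trans hax))
      rw [if_neg (fun h => hl (Finset.mem_Icc.1 h).2), add_zero]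
      have h1 : η * (l : ℝ) ^ (-2 : ℝ) ≤ (l : ℝ) ^ (-2 : ℝ) :=
        mul_le_of_le_one_left hl2.le hη1
      have h2 : -Real.log (η * (l : ℝ) ^ (-2 : ℝ)) = c * (N : ℝ) ^ m + 2 * Real.log l := by
        rw [Real.log_mul hη0.ne' hl2.ne', Real.log_rpow hl0]
        linarith
      have h3 : G l * (c * (N : ℝ) ^ m + 2 * Real.log l) ≤
          A * (c * (N : ℝ) ^ m) * (l : ℝ) ^ (-2 : ℝ) + 4 * A * (l : ℝ) ^ (-(3 / 2) : ℝ) := by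
        have h4 := log_le_two_mul_rpow_half l
        have h5 : (l : ℝ) ^ (-(3 / 2) : ℝ) = (l : ℝ) ^ (-2 : ℝ) * (l : ℝ) ^ (1 / 2 : ℝ) := by
          rw [← Real.rpow_add hl0]; norm_num
        have h6 : 0 ≤ Real.log l := Real.log_nonneg hl1
        calc G l * (c * (N : ℝ) ^ m + 2 * Real.log l)
            ≤ A * (l : ℝ) ^ (-2 : ℝ) * (c * (N : ℝ) ^ m + 2 * (2 * (l : ℝ) ^ (1 / 2 : ℝ))) := by
              gcongr
              exact hG2 l
          _ = _ := by rw [h5]; ring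
      have h4 : b₀ * Real.exp (-(G l * (l : ℝ) ^ (α + 1))) ≤ b₀ * Real.exp (-(a * (l : ℝ))) := by
        gcongr
      have h5 := (hf l).le
      rw [h2]
      simp only [hu]
      linarith
  · have h1 : ∑ l ∈ s, u l ≤ 3 * 1 + (1 + M * A + A * (c * (N : ℝ) ^ m)) * Z + 4 * A * Z₁ +
        b₀ * Z₂ := sum_le_hasSum s (fun l _ => hu0 l) husum
    have h2 : ∑ l ∈ s, (if l ∈ Finset.Icc 1 N then v l else 0) ≤ ∑ l ∈ Finset.Icc 1 N, v l :=
      sum_le_hasSum s (fun l _ => by split_ifs; exacts [hv0 l, le_rfl])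
        (hasSum_indicator_finset (Finset.Icc 1 N) v)
    have h3 : ∑ l ∈ Finset.Icc 1 N, v l ≤ A * (B * (N : ℝ) ^ K) +
        N * (c * (N : ℝ) ^ m + α * Real.log N + |Real.log a|) := by
      simp only [hv]
      rw [Finset.sum_add_distrib, ← Finset.mul_sum, Finset.sum_const, nsmul_eq_mul]
      have : (Finset.Icc 1 N).card = (N : ℕ) := by rw [PNat.card_Icc]; simp
      rw [this]
      gcongr
    rw [Finset.sum_add_distrib]
    refine (add_le_add h1 (h2.trans h3)).trans ?_
    have hNm : 1 ≤ (N : ℝ) ^ m := Real.one_le_rpow hN1 hm.le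
    have hNm1 : (N : ℝ) ^ (m + 1) = N * (N : ℝ) ^ m := by
      rw [Real.rpow_add hN0, Real.rpow_one, mul_comm]
    have hle : (N : ℝ) ^ m ≤ N * (N : ℝ) ^ m := le_mul_of_one_le_left (by linarith) hN1
    have hone : 1 ≤ N * (N : ℝ) ^ m := hNm.trans hle
    have hNK : 0 < (N : ℝ) ^ K := by positivity
    have k1 : (3 + (1 + M * A) * Z + 4 * A * Z₁ + b₀ * Z₂) ≤
        (3 + (1 + M * A) * Z + 4 * A * Z₁ + b₀ * Z₂) * (N * (N : ℝ) ^ m) :=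
      le_mul_of_one_le_right (by positivity) hone
    have k2 : A * c * Z * (N : ℝ) ^ m ≤ A * c * Z * (N * (N : ℝ) ^ m) := by gcongr
    have k3 : (N : ℝ) * (c * (N : ℝ) ^ m + α * Real.log N + |Real.log a|) ≤
        (c + α / m + |Real.log a|) * (N * (N : ℝ) ^ m) := by
      have k4 : c * (N : ℝ) ^ m + α * Real.log N + |Real.log a| ≤
          (c + α / m + |Real.log a|) * (N : ℝ) ^ m := by
        have k5 : α * Real.log N ≤ α * ((N : ℝ) ^ m / m) := by gcongr
        have k6 : |Real.log a| ≤ |Real.log a| * (N : ℝ) ^ m :=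
          le_mul_of_one_le_right (abs_nonneg _) hNm
        have k7 : α * ((N : ℝ) ^ m / m) = α / m * (N : ℝ) ^ m := by ring
        linarith
      calc (N : ℝ) * (c * (N : ℝ) ^ m + α * Real.log N + |Real.log a|)
          ≤ N * ((c + α / m + |Real.log a|) * (N : ℝ) ^ m) := by gcongr
        _ = _ := by ring
    have k8 : 0 ≤ D₁ * (N : ℝ) ^ K := by positivity
    have k9 : 0 ≤ A * B * (N * (N : ℝ) ^ m) := by positivity
    rw [hNm1]
    have k10 : D₁ * (N * (N : ℝ) ^ m) = (3 + (1 + M * A) * Z + 4 * A * Z₁ + b₀ * Z₂) *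
        (N * (N : ℝ) ^ m) + A * c * Z * (N * (N : ℝ) ^ m) +
          (c + α / m + |Real.log a|) * (N * (N : ℝ) ^ m) := by rw [hD₁]; ring
    have k11 : (D₁ + A * B) * (N * (N : ℝ) ^ m + (N : ℝ) ^ K) = D₁ * (N * (N : ℝ) ^ m) +
        A * (B * (N : ℝ) ^ K) + D₁ * (N : ℝ) ^ K + A * B * (N * (N : ℝ) ^ m) := by ring
    rw [k11, k10]
    linarith

lemma exists_uniform_envelope {k : ℕ} {f' : Fin k → Density} {m c K : ℝ}
    (hD : ∀ j, f' j ∈ envelopeClass m c K) :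
    ∃ (d B : ℝ) (N₀ : ℕ+), 0 ≤ d ∧ 0 < B ∧
      (∀ j (l : ℕ+), f' j l ≤ d * Real.exp (-c * (l : ℝ) ^ m)) ∧
      ∀ N : ℕ+, N₀ ≤ N → ∀ j,
        ∑ l ∈ Finset.Icc 1 N, -Real.log (f' j l) / (l : ℝ) ≤ B * (N : ℝ) ^ K := by
  choose hd hpos hB using hD
  choose d hd0 hd using hd
  choose B hB0 hB using hB
  obtain ⟨N₀, hN₀⟩ := eventually_atTop.1 (eventually_all.2 hB)
  have hsB : 0 ≤ ∑ j, B j := Finset.sum_nonneg fun j _ => (hB0 j).le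
  refine ⟨∑ j, d j, ∑ j, B j + 1, N₀, Finset.sum_nonneg fun j _ => (hd0 j).le,
    by linarith, fun j l => (hd j l).trans ?_,
    fun N hN j => (hN₀ N hN j).trans ?_⟩
  · gcongr
    exact Finset.single_le_sum (fun j _ => (hd0 j).le) (Finset.mem_univ j)
  · gcongr
    have := Finset.single_le_sum (fun j _ => (hB0 j).le) (Finset.mem_univ j)
    linarith

/-- The decay e^{-c l^m} of f* is halved: one half yields the small factor E = exp(-(c/2) N^m),
which is also the box width η, and the other keeps f* V² summable. -/
lemma exists_closeDensities {k : ℕ} [NeZero k] {G : ℕ+ → ℝ} (hP : AssumptionP G)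
    {f' : Fin k → Density} {m c K : ℝ} (hm : 0 < m) (hc : 0 < c) (hK : 0 < K)
    (hD : ∀ j, f' j ∈ envelopeClass m c K) :
    ∃ (ρ₀ D : ℝ) (N₀ : ℕ+) (V : ℕ+ → ℝ), 0 < ρ₀ ∧ 0 < D ∧ ∀ (N : ℕ+) (ρ : ℝ), N₀ ≤ N →
      ρ = ρ₀ * Real.exp (-(c / 2 * (N : ℝ) ^ m)) → ρ ≤ 1 →
      (∀ j, ENNReal.ofReal (Real.exp (-(D * ((N : ℝ) ^ (m + 1) + (N : ℝ) ^ K)))) ≤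
        dirichletProcess G (closeDensities (f' j) N ρ V)) ∧
      ∀ f : Fin k → Density, (∀ j, f j ∈ closeDensities (f' j) N ρ V) →
        ∀ e u : ℝ, 4 * ρ ≤ e ^ 2 → 4 * ρ ≤ e ^ 2 / u → KLConditions f' f e u := by
  obtain ⟨a, A, α, ha, haA, hα, hG⟩ := hP
  obtain ⟨d, B, N₀, hd0, hB0, hd, hB⟩ := exists_uniform_envelope hD
  have hpos : ∀ j l, 0 < f' j l := fun j => (hD j).2.1
  obtain ⟨D, hD0, hbox⟩ := exists_le_infinitePi_gammaBox ha (ha.trans_le haA) hα hG hm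
    (half_pos hc) hB0 (K := K)
  set Z := ∑' l : ℕ+, (l : ℝ) ^ (-2 : ℝ) with hZ
  have hZ0 : 0 ≤ Z := tsum_nonneg fun l => by positivity
  -- The power l^p dominates l^m, l^{α+1}, l^{K+1} and log l. In κ, c/2 + 4 + Z bounds minus the
  -- logarithm of the normalised lower endpoints, and B bounds -log f*.
  set p := m + α + K + 1 with hp
  have hp1 : 1 ≤ p := by linarith
  set κ := c / 2 + 4 + Z + B with hκ
  have hκ0 : 0 < κ := by positivity
  set V : ℕ+ → ℝ := fun l => κ * (l : ℝ) ^ p with hV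
  set H : ℕ+ → ℝ := fun l =>
    d * (1 + κ ^ 2) * ((l : ℝ) ^ (2 * p) * Real.exp (-(c / 2) * (l : ℝ) ^ m)) with hH
  have hHs : Summable H :=
    (summable_pnat_rpow_mul_exp (by linarith) (half_pos hc) hm).mul_left _
  have hH0 : ∀ l, 0 ≤ H l := fun l => by simp only [hH]; positivity
  set Hs := ∑' l, H l with hHsum
  have hHs0 : 0 ≤ Hs := tsum_nonneg hH0
  -- Here 1 + Z + 2 Hs is what normalisation requires with τ = E Hs, and 3 Hs together with ρ ≤ 1
  -- ensures τ ≤ 1/2.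
  refine ⟨1 + Z + 3 * Hs, D, N₀, V, by positivity, hD0, fun N ρ hN hρ hρ1 => ?_⟩
  set E := Real.exp (-(c / 2 * (N : ℝ) ^ m)) with hE
  have hE0 : 0 < E := Real.exp_pos _
  have hN0 : (0 : ℝ) < N := by exact_mod_cast N.pos
  have hEle : E ≤ 1 := Real.exp_le_one_iff.2 (by
    have : 0 ≤ c / 2 * (N : ℝ) ^ m := by positivity
    linarith)
  have hone : ∀ l : ℕ+, 1 ≤ (l : ℝ) ^ p := fun l =>
    Real.one_le_rpow (one_le_pnat l) (by linarith)
  have hexp : ∀ l : ℕ+, N < l →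
      Real.exp (-c * (l : ℝ) ^ m) ≤ E * Real.exp (-(c / 2) * (l : ℝ) ^ m) := by
    intro l hl
    have hNl : (N : ℝ) ≤ l := by exact_mod_cast hl.le
    rw [hE, ← Real.exp_add]
    apply Real.exp_le_exp.2
    have : c / 2 * (N : ℝ) ^ m ≤ c / 2 * (l : ℝ) ^ m := by gcongr
    linarith
  have hsq : ∀ l : ℕ+, (l : ℝ) ^ (2 * p) = ((l : ℝ) ^ p) ^ 2 := fun l => by
    rw [mul_comm, Real.rpow_mul (by positivity), Real.rpow_two]
  have hf'V : ∀ j l, N < l → f' j l * V l ^ 2 ≤ E * H l := by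
    intro j l hl
    calc f' j l * V l ^ 2 ≤ d * (E * Real.exp (-(c / 2) * (l : ℝ) ^ m)) * V l ^ 2 := by
          gcongr
          exact (hd j l).trans (mul_le_mul_of_nonneg_left (hexp l hl) hd0)
      _ = E * (d * κ ^ 2 * ((l : ℝ) ^ (2 * p) * Real.exp (-(c / 2) * (l : ℝ) ^ m))) := by
          simp only [hV, hsq]; ring
      _ ≤ E * H l := by
          simp only [hH]
          gcongr
          linarith
  have hf'H : ∀ j l, N < l → f' j l ≤ E * H l := by
    intro j l hl
    calc f' j l ≤ d * (E * Real.exp (-(c / 2) * (l : ℝ) ^ m)) :=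
          (hd j l).trans (mul_le_mul_of_nonneg_left (hexp l hl) hd0)
      _ = E * (d * 1 * (1 * Real.exp (-(c / 2) * (l : ℝ) ^ m))) := by ring
      _ ≤ E * H l := by
          simp only [hH]
          gcongr
          · nlinarith
          · rw [hsq]
            exact one_le_pow₀ (hone l)
  have hEH : E * Hs * 3 ≤ ρ ∧ E * (1 + Z) + 2 * (E * Hs) ≤ ρ := by
    rw [hρ]
    have h1 : 0 ≤ E * Hs := by positivity
    have h2 : 0 ≤ E * (1 + Z) := by positivity
    constructor <;> linarith
  have hlpow : ∀ (l : ℕ+) (s : ℝ), s ≤ p → (l : ℝ) ^ s ≤ (l : ℝ) ^ p := fun l s hs =>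
    Real.rpow_le_rpow_of_exponent_le (one_le_pnat l) hs
  constructor
  · intro j
    refine (hbox (f' j) N (hpos j) (hB N hN j)).trans ?_
    rw [dirichletProcess, Measure.map_apply measurable_normalise
      (measurableSet_closeDensities _ _ _ _)]
    refine measure_mono fun γ hγ => ?_
    have hγ' : ∀ l, γ l ∈ gammaBox (f' j) N E (α + 1) l := fun l => hγ l (Set.mem_univ l)
    refine normalise_mem_closeDensities (η := E) (τ := E * Hs)
      (lo := fun l => E * (l : ℝ) ^ (-2 : ℝ) * Real.exp (-(l : ℝ) ^ (α + 1)))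
      (hpos j) hE0.le hEle (by linarith [hEH.1, mul_nonneg hE0.le hHs0]) ?_ (fun l hl => ?_)
      (fun l => by positivity) (fun l hl => ?_) hEH.2 (fun l hl => ?_)
    · have h1 : HasSum (fun l => E * H l + if l ∈ Finset.Icc 1 N then f' j l else 0)
          (E * Hs + ∑ l ∈ Finset.Icc 1 N, f' j l) :=
        (hHs.hasSum.mul_left E).add (hasSum_indicator_finset _ _)
      have h2 := hasSum_le (fun l => ?_) (f' j).2.2 h1
      · linarith
      · have h3 := mul_nonneg hE0.le (hH0 l)
        split_ifs with hl
        · linarith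
        · rw [add_zero]
          exact hf'H j l (not_le.1 fun h => hl (Finset.mem_Icc.2 ⟨one_le, h⟩))
    · have h1 := hγ' l
      rw [gammaBox, if_pos hl] at h1
      exact h1
    · have h1 := hγ' l
      rw [gammaBox, if_neg (not_le.2 hl)] at h1
      exact h1
    · have hl0 : (0 : ℝ) < l := by exact_mod_cast l.pos
      have hNl : (N : ℝ) ≤ l := by exact_mod_cast hl.le
      rw [Real.log_mul (by positivity) (Real.exp_pos _).ne', Real.log_mul hE0.ne' (by positivity),
        Real.log_rpow hl0, Real.log_exp, Real.log_exp, ← hZ]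
      have h1 : c / 2 * (N : ℝ) ^ m ≤ c / 2 * (l : ℝ) ^ p := by
        gcongr ?_ * ?_
        exact (Real.rpow_le_rpow hN0.le hNl hm.le).trans (hlpow l m (by linarith))
      have h2 : Real.log l ≤ (l : ℝ) ^ p := by
        refine (Real.log_le_self hl0.le).trans ?_
        have := hlpow l 1 hp1
        rwa [Real.rpow_one] at this
      have h3 := hlpow l (α + 1) (by linarith)
      have h4 : 1 + Z ≤ (1 + Z) * (l : ℝ) ^ p := le_mul_of_one_le_right (by positivity) (hone l)
      have h5 : 0 ≤ B * (l : ℝ) ^ p := by positivity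
      simp only [hV, hκ]
      linarith
  · intro f hf e u he heu
    refine klConditions_of_close (N := N) (ρ := ρ) (W := V) (h := fun l => E * H l) hpos
      (fun j l => (hf j l).1) hρ1 (fun j l hl => (hf j l).2.1 hl) (fun j l hl => ?_)
      (fun l => mul_nonneg hE0.le (hH0 l)) (hHs.mul_left E) ?_ hf'V hf'H he heu
    · have hl0 : (0 : ℝ) < l := by exact_mod_cast l.pos
      obtain ⟨h1, -, h2⟩ := hf j l
      have h3 := (Real.le_log_iff_exp_le h1).2 (h2 hl)
      have h4 := Real.log_nonpos h1.le ((f j).le_one l)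
      have h5 := Real.log_nonpos (hpos j l).le ((f' j).le_one l)
      have h6 : -Real.log (f' j l) ≤ V l := by
        -- Keeping only the last term of the sum up to l gives -log f*(l) ≤ B l^{K+1}. Both
        -- densities then lie in [e^{-V(l)}, 1], which bounds the log-ratio by V(l).
        have h7 : -Real.log (f' j l) / (l : ℝ) ≤ B * (l : ℝ) ^ K := by
          refine le_trans ?_ (hB l (hN.trans hl.le) j)
          refine Finset.single_le_sum (f := fun l : ℕ+ => -Real.log (f' j l) / (l : ℝ))
            (fun i _ => ?_) (Finset.mem_Icc.2 ⟨one_le, le_rfl⟩)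
          have := Real.log_nonpos (hpos j i).le ((f' j).le_one i)
          exact div_nonneg (by linarith) (by positivity)
        rw [div_le_iff₀ hl0, mul_assoc, ← Real.rpow_add_one hl0.ne'] at h7
        refine h7.trans ?_
        simp only [hV]
        have h8 := hlpow l (K + 1) (by linarith)
        gcongr
        linarith
      rw [Real.log_div (hpos j l).ne' h1.ne', abs_le]
      constructor <;> linarith
    · rw [tsum_mul_left]
      linarith [hEH.1, mul_nonneg hE0.le hHs0]

lemma le_emissionPrior {k : ℕ} {G : ℕ+ → ℝ} {S : Fin k → Set Density} {w : ℝ}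
    (h : ∀ j, ENNReal.ofReal (Real.exp (-w)) ≤ dirichletProcess G (S j)) :
    Real.exp (-(k * w)) ≤ (emissionPrior k G).real (Set.univ.pi S) := by
  rw [Measure.real, emissionPrior, Measure.pi_pi]
  have h1 : ENNReal.ofReal (Real.exp (-(k * w))) ≤ ∏ j, dirichletProcess G (S j) := by
    calc ENNReal.ofReal (Real.exp (-(k * w)))
        = ∏ _j : Fin k, ENNReal.ofReal (Real.exp (-w)) := by
          rw [Finset.prod_const, Finset.card_univ, Fintype.card_fin,
            ← ENNReal.ofReal_pow (Real.exp_pos _).le, ← Real.exp_nat_mul, mul_neg]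
      _ ≤ _ := Finset.prod_le_prod' fun j _ => h j
  exact (ENNReal.ofReal_le_iff_le_toReal
    (ENNReal.prod_ne_top fun j _ => measure_ne_top _ _)).1 h1

/-- Taking N^m of order log n makes ρ smaller than a multiple of n^{-3}; the costs N^{m+1} and N^K
become the powers 1/m + 1 and K/m of log n. -/
lemma exists_assumptionA {k : ℕ} [NeZero k] {G : ℕ+ → ℝ} (hP : AssumptionP G)
    {f' : Fin k → Density} {m c K : ℝ} (hm : 0 < m) (hc : 0 < c) (hK : 0 < K)
    (hD : ∀ j, f' j ∈ envelopeClass m c K) {t₀ : ℝ} (ht₀m : 1 / m + 1 ≤ 2 * t₀)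
    (ht₀K : K / m ≤ 2 * t₀) :
    ∃ Cf : ℝ, AssumptionA (emissionPrior k G) f' (logRate t₀) Cf := by
  obtain ⟨ρ₀, D, N₀, V, hρ₀, hD0, hclose⟩ := exists_closeDensities hP hm hc hK hD
  have hm' : 0 < 1 / m := by positivity
  have hk : (0 : ℝ) < k := by exact_mod_cast Nat.pos_of_ne_zero (NeZero.ne k)
  have h2 : 0 < Real.log 2 := Real.log_pos (by norm_num)
  have h21 : Real.log 2 ≤ 1 := by linarith [Real.log_two_lt_d9]
  obtain ⟨D₁, hD₁, hlog₁⟩ := log_rpow_le_mul_log_rpow ht₀m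
  obtain ⟨D₂, hD₂, hlog₂⟩ := log_rpow_le_mul_log_rpow ht₀K
  set v := Real.log 2 ^ (2 * t₀) with hv
  have hv0 : 0 < v := by positivity
  have hv1 : v ≤ 1 := Real.rpow_le_one h2.le h21 (by linarith)
  have hN₀0 : (0 : ℝ) < N₀ := by exact_mod_cast N₀.pos
  set s := 4 * ρ₀ / v / Real.log 2 with hs
  have hs0 : 0 < s := by positivity
  -- In Λ the 3 produces n^{-3}, the s absorbs the constant 4ρ₀/v (since s log 2 = 4ρ₀/v ≤
  -- e^{4ρ₀/v}), and the last term forces N ≥ N₀ already at n = 2.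
  set Λ := 2 / c * (3 + s) + (N₀ : ℝ) ^ m / Real.log 2 with hΛ
  have hΛ0 : 0 < Λ := by positivity
  set N : ℕ → ℕ+ := fun n => Nat.succPNat ⌊(Λ * Real.log n) ^ (1 / m)⌋₊ with hN
  set ρ : ℕ → ℝ := fun n => ρ₀ * Real.exp (-(c / 2 * (N n : ℝ) ^ m)) with hρ
  -- The second summand absorbs the rounding error 1 in N, because log n ≥ log 2.
  set Q := Λ ^ (1 / m) + Real.log 2 ^ (-(1 / m)) with hQ
  have hQ0 : 0 < Q := by positivity
  set D₃ := D * (Q ^ (m + 1) * D₁ + Q ^ K * D₂) with hD₃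
  have hD₃0 : 0 < D₃ := by positivity
  have hNm : ∀ n : ℕ, 2 ≤ n → Λ * Real.log n ≤ (N n : ℝ) ^ m := by
    intro n hn
    have hl := log_natCast_pos hn
    have h1 : (Λ * Real.log n) ^ (1 / m) ≤ (N n : ℝ) := by
      have := (Nat.lt_floor_add_one ((Λ * Real.log n) ^ (1 / m))).le
      simpa [hN] using this
    calc Λ * Real.log n = ((Λ * Real.log n) ^ (1 / m)) ^ m := by
          rw [← Real.rpow_mul (by positivity), one_div_mul_cancel hm.ne', Real.rpow_one]
      _ ≤ (N n : ℝ) ^ m := by gcongr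
  have hNle : ∀ n : ℕ, 2 ≤ n → (N n : ℝ) ≤ Q * Real.log n ^ (1 / m) := by
    intro n hn
    have hl := log_natCast_pos hn
    have h1 : (N n : ℝ) ≤ (Λ * Real.log n) ^ (1 / m) + 1 := by
      have := Nat.floor_le (a := (Λ * Real.log n) ^ (1 / m)) (by positivity)
      simpa [hN] using this
    have h3 : 1 ≤ Real.log 2 ^ (-(1 / m)) * Real.log n ^ (1 / m) := by
      rw [Real.rpow_neg h2.le, ← div_eq_inv_mul, ← Real.div_rpow hl.le h2.le]
      exact Real.one_le_rpow ((one_le_div h2).2 (log_two_le_log_natCast hn)) hm'.le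
    rw [Real.mul_rpow hΛ0.le hl.le] at h1
    rw [hQ, add_mul]
    linarith
  have hNN₀ : ∀ n : ℕ, 2 ≤ n → N₀ ≤ N n := by
    intro n hn
    have h1 : (N₀ : ℝ) ^ m ≤ (N n : ℝ) ^ m := by
      refine le_trans ?_ (hNm n hn)
      calc (N₀ : ℝ) ^ m = (N₀ : ℝ) ^ m / Real.log 2 * Real.log 2 := by field_simp
        _ ≤ Λ * Real.log n := by
            gcongr
            · rw [hΛ]
              have : 0 ≤ 2 / c * (3 + s) := by positivity
              linarith
            · exact_mod_cast hn
    have h3 := (Real.rpow_le_rpow_iff hN₀0.le (by positivity) hm).1 h1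
    exact_mod_cast h3
  have hρle : ∀ n : ℕ, 2 ≤ n → 4 * ρ n ≤ v / (n : ℝ) ^ 3 := by
    intro n hn
    have hl := log_natCast_pos hn
    have hn0 : (0 : ℝ) < n := by exact_mod_cast (by omega : 0 < n)
    have h1 : (3 + s) * Real.log n ≤ c / 2 * (N n : ℝ) ^ m := by
      calc (3 + s) * Real.log n = c / 2 * (2 / c * (3 + s) * Real.log n) := by field_simp
        _ ≤ c / 2 * (Λ * Real.log n) := by
            gcongr
            rw [hΛ]
            have : 0 ≤ (N₀ : ℝ) ^ m / Real.log 2 := by positivity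
            linarith
        _ ≤ c / 2 * (N n : ℝ) ^ m := by
            gcongr
            exact hNm n hn
    have h3 : Real.exp (-(c / 2 * (N n : ℝ) ^ m)) ≤
        Real.exp (-(s * Real.log 2)) * Real.exp (-(3 * Real.log n)) := by
      rw [← Real.exp_add]
      apply Real.exp_le_exp.2
      have : s * Real.log 2 ≤ s * Real.log n :=
        mul_le_mul_of_nonneg_left (log_two_le_log_natCast hn) hs0.le
      linarith
    have h4 : Real.exp (-(3 * Real.log n)) = 1 / (n : ℝ) ^ 3 := by
      rw [Real.exp_neg, one_div]
      congr 1
      have : (3 : ℝ) * Real.log n = ((3 : ℕ) : ℝ) * Real.log n := by norm_num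
      rw [this, Real.exp_nat_mul, Real.exp_log hn0]
    have h5 : 4 * ρ₀ * Real.exp (-(s * Real.log 2)) ≤ v := by
      have h6 : s * Real.log 2 = 4 * ρ₀ / v := by rw [hs]; field_simp
      have h7 := Real.add_one_le_exp (4 * ρ₀ / v)
      rw [h6, Real.exp_neg, ← div_eq_mul_inv, div_le_iff₀ (Real.exp_pos _)]
      calc 4 * ρ₀ = v * (4 * ρ₀ / v) := by field_simp
        _ ≤ v * Real.exp (4 * ρ₀ / v) := by gcongr; linarith
    calc 4 * ρ n = 4 * ρ₀ * Real.exp (-(c / 2 * (N n : ℝ) ^ m)) := by simp only [hρ]; ring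
      _ ≤ 4 * ρ₀ * (Real.exp (-(s * Real.log 2)) * Real.exp (-(3 * Real.log n))) := by gcongr
      _ = 4 * ρ₀ * Real.exp (-(s * Real.log 2)) * (1 / (n : ℝ) ^ 3) := by rw [h4]; ring
      _ ≤ v * (1 / (n : ℝ) ^ 3) := by gcongr
      _ = v / (n : ℝ) ^ 3 := by ring
  have hρ1 : ∀ n : ℕ, 2 ≤ n → ρ n ≤ 1 := by
    intro n hn
    have hn1 : (1 : ℝ) ≤ n := by exact_mod_cast (by omega : 1 ≤ n)
    have h1 := hρle n hn
    have h3 : v / (n : ℝ) ^ 3 ≤ 1 := by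
      rw [div_le_one (by positivity)]
      exact hv1.trans (one_le_pow₀ hn1)
    linarith
  refine ⟨k * D₃, by positivity,
    fun n => Set.univ.pi fun j => closeDensities (f' j) (N n) (ρ n) V, fun n => ?_,
    ⟨1, one_pos, fun n hn => ?_⟩, fun n hn f hf => ?_⟩
  · exact MeasurableSet.univ_pi fun j => measurableSet_closeDensities _ _ _ _
  · have hl := log_natCast_pos hn
    obtain ⟨h1, -⟩ := hclose (N n) (ρ n) (hNN₀ n hn) rfl (hρ1 n hn)
    refine le_trans ?_ (le_emissionPrior h1)
    rw [one_mul]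
    apply Real.exp_le_exp.2
    have h3 : (N n : ℝ) ^ (m + 1) ≤ Q ^ (m + 1) * (D₁ * Real.log n ^ (2 * t₀)) := by
      calc (N n : ℝ) ^ (m + 1) ≤ (Q * Real.log n ^ (1 / m)) ^ (m + 1) := by
            gcongr
            exact hNle n hn
        _ = Q ^ (m + 1) * Real.log n ^ (1 / m + 1) := by
            rw [Real.mul_rpow hQ0.le (by positivity), ← Real.rpow_mul hl.le]
            congr 2
            field_simp
            ring
        _ ≤ _ := by
            gcongr
            exact hlog₁ n hn
    have h4 : (N n : ℝ) ^ K ≤ Q ^ K * (D₂ * Real.log n ^ (2 * t₀)) := by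
      calc (N n : ℝ) ^ K ≤ (Q * Real.log n ^ (1 / m)) ^ K := by
            gcongr
            exact hNle n hn
        _ = Q ^ K * Real.log n ^ (K / m) := by
            rw [Real.mul_rpow hQ0.le (by positivity), ← Real.rpow_mul hl.le]
            congr 2
            field_simp
        _ ≤ _ := by
            gcongr
            exact hlog₂ n hn
    rw [mul_assoc, mul_logRate_sq t₀ hn, neg_mul, neg_le_neg_iff, mul_assoc]
    refine mul_le_mul_of_nonneg_left ?_ hk.le
    calc D * ((N n : ℝ) ^ (m + 1) + (N n : ℝ) ^ K)
        ≤ D * (Q ^ (m + 1) * (D₁ * Real.log n ^ (2 * t₀)) +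
            Q ^ K * (D₂ * Real.log n ^ (2 * t₀))) := by gcongr
      _ = D₃ * Real.log n ^ (2 * t₀) := by rw [hD₃]; ring
  · obtain ⟨-, h1⟩ := hclose (N n) (ρ n) (hNN₀ n hn) rfl (hρ1 n hn)
    have ht₀0 : 0 ≤ t₀ := by linarith
    exact h1 f (fun j => hf j (Set.mem_univ j)) _ _
      ((hρle n hn).trans (le_logRate_sq ht₀0 hn))
      ((hρle n hn).trans (le_logRate_sq_div_uSeq ht₀0 _ hn))

end DiscreteHMM

end

/-! ### Assembly of the three conditions -/

open DiscreteHMM in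
theorem theorem2 {k : ℕ} [NeZero k]
    -- the true transition matrix and the prior on transition matrices
    (Qstar : Fin k → Fin k → ℝ) (q : ℝ) (hq : 0 < q) (hQstar : Qstar ∈ transitionMatrices k q)
    (PiQ : MeasureTheory.Measure (Fin k → Fin k → ℝ)) [MeasureTheory.IsProbabilityMeasure PiQ]
    (hQ0 : AssumptionQ0 PiQ Qstar)
    -- the base measure of the Dirichlet process prior
    (G : ℕ+ → ℝ) (hP : AssumptionP G)
    -- the true emission densities
    (fstar : Fin k → Density) (m c K : ℝ) (hm : 0 < m) (hc : 0 < c) (hK : 0 < K)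
    (hD : ∀ j, fstar j ∈ envelopeClass m c K) (hI : AssumptionI fstar m c)
    -- the exponents of the rates
    (t₀ t : ℝ) (ht₀ : 1 / 2 * max (1 / m + 1) (K / m) ≤ t₀) (ht : 4 * t₀ < t) :
    ∃ Cf C C' : ℝ,
      AssumptionA (emissionPrior k G) fstar (logRate t₀) Cf ∧
      AssumptionB (emissionPrior k G) (logRate t₀) (logRate t) C C' ∧
      AssumptionC PiQ Qstar q (logRate t₀) Cf C := by
  -- `hI` is not needed: the tail bounds it provides already follow from `hD`.
  have h1 := le_max_left (1 / m + 1) (K / m)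
  have h2 := le_max_right (1 / m + 1) (K / m)
  have hm' : 0 < 1 / m := by positivity
  have ht₀1 : 1 ≤ 2 * t₀ := by linarith
  obtain ⟨Cf, hA⟩ := exists_assumptionA hP hm hc hK hD (t₀ := t₀) (by linarith) (by linarith)
  obtain ⟨CQ, hCQ, b, hb, hC⟩ := exists_prior_rate hq hQstar PiQ hQ0 ht₀1
  -- The sieve exists for every positive C, so C is fixed only now, above C_Q + C_f + C_K; the
  -- absolute value secures positivity.
  obtain ⟨C', hB⟩ := exists_assumptionB (k := k) hP ht₀1 ht
    (C := |CQ + Cf + constCK k q| + 1) (by positivity)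
  exact ⟨Cf, |CQ + Cf + constCK k q| + 1, C', hA, hB, CQ, hCQ,
    by linarith [le_abs_self (CQ + Cf + constCK k q)], b, hb, hC⟩
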